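/- Let $\mathbb{H}^2$ be the hyperbolic plane and let $G_0=\mathrm{PSL}_2(\mathbb{R})$ be its group of orientation-preserving isometries, identified with the $3$-dimensional anti-de Sitter space. For a geodesic line $\ell$ of $\mathbb{H}^2$, let $\mathsf{C}(\ell)\subset G_0$ be the union of $\{e\}$, of the set of elliptic elements whose fixed point lies on $\ell$, of the set of parabolic elements fixing an endpoint at infinity of $\ell$, and of the set of hyperbolic elements whose attracting fixed point is an endpoint at infinity of $\ell$. The right AdS crooked plane centered at $e$ associated with $\ell$ is $\mathsf{C}^*(\ell):=\mathsf{C}(\ell)^{-1}=\{h^{-1} : h\in \mathsf{C}(\ell)\}$. A transverse orientation of $\ell$ is the choice of one of the two components of $\mathbb{H}^2\smallsetminus\ell$, called the positive side of $\ell$. For a transversely oriented line $\ell$, the stem quadrant $\mathsf{SQ}(\ell)\subset G_0$ is the set of hyperbolic elements whose axis is orthogonal to $\ell$ and which translate towards the positive side of $\ell$. Two disjoint transversely oriented lines are oriented away from each other if their positive sides are disjoint. **Theorem.** Let $\ell,\ell'$ be geodesic lines of $\mathbb{H}^2$ and let $g,g'\in G_0$. Consider the following conditions: (C) the right AdS crooked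 planes $g\,\mathsf{C}^*(\ell)$ and $g'\,\mathsf{C}^*(\ell')$ are disjoint; (D) the geodesic lines $\ell$ and $\ell'$ are disjoint, and $g^{-1}g'\in\mathsf{SQ}(\ell)\,\mathsf{SQ}(\ell')^{-1}$ for the transverse orientations of $\ell$ and $\ell'$ away from each other. Then (C) $\Rightarrow$ (D) always holds, and (D) $\Rightarrow$ (C) holds under the assumption that $g$ and $g'$ take $\ell$ and $\ell'$ (with the transverse orientations of (D)) to disjoint geodesic lines $g\cdot\ell$ and $g'\cdot\ell'$ transversely oriented away from each other. -/

import Mathlib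

open scoped UpperHalfPlane MatrixGroups Pointwise Topology

namespace AdSCrooked

/-- The group `G₀ = PSL₂(ℝ)`, which is both the group of orientation-preserving isometries of the
hyperbolic plane `ℍ` and the underlying space of anti-de Sitter 3-space, on which `G₀` acts by left
multiplication. -/
abbrev G₀ : Type := PSL(2, ℝ)

/-! ### Actions of `G₀` on the hyperbolic plane and on its ideal boundary -/

/-- The action of `PSL₂(ℝ)` on the upper half-plane by Möbius transformations. -/
noncomputable instance : MulAction G₀ ℍ :=
  MulAction.compHom ℍ (Matrix.ProjectiveSpecialLinearGroup.toPGL (n := Fin 2) (R := ℝ))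

lemma mk_smul (A : SL(2, ℝ)) (z : ℍ) : ((A : G₀) • z : ℍ) = A • z := rfl

lemma glScalar_smul_onePoint (u : ℝˣ) (ξ : OnePoint ℝ) :
    Matrix.GeneralLinearGroup.scalar (Fin 2) u • ξ = ξ := by
  cases ξ with
  | infty => simp [OnePoint.smul_infty_eq_ite]
  | coe c => simp [OnePoint.smul_some_eq_ite]

/-- The action of `PGL₂(ℝ)` on the ideal boundary `ℝ ∪ {∞}` of `ℍ`. -/
noncomputable instance : MulAction PGL(2, ℝ) (OnePoint ℝ) :=
  Matrix.ProjGenLinGroup.mulActionOfGL glScalar_smul_onePoint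

/-- The action of `PSL₂(ℝ)` on the ideal boundary `ℝ ∪ {∞}` of `ℍ`. -/
noncomputable instance : MulAction G₀ (OnePoint ℝ) :=
  MulAction.compHom (OnePoint ℝ)
    (Matrix.ProjectiveSpecialLinearGroup.toPGL (n := Fin 2) (R := ℝ))

lemma mk_smul_onePoint (A : SL(2, ℝ)) (ξ : OnePoint ℝ) :
    ((A : G₀) • ξ : OnePoint ℝ) = (A : GL (Fin 2) ℝ) • ξ := rfl

/-! ### Elliptic, parabolic and hyperbolic elements -/

/-- `h` is elliptic: a representative has two non-real eigenvalues. -/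
def IsElliptic (h : G₀) : Prop :=
  ∃ A : SL(2, ℝ), (A : G₀) = h ∧ (A : Matrix (Fin 2) (Fin 2) ℝ).IsElliptic

/-- `h` is parabolic: a representative is non-scalar with a double real eigenvalue. -/
def IsParabolic (h : G₀) : Prop :=
  ∃ A : SL(2, ℝ), (A : G₀) = h ∧ (A : Matrix (Fin 2) (Fin 2) ℝ).IsParabolic

/-- `h` is hyperbolic: a representative has two distinct real eigenvalues. -/
def IsHyperbolic (h : G₀) : Prop :=
  ∃ A : SL(2, ℝ), (A : G₀) = h ∧ (A : Matrix (Fin 2) (Fin 2) ℝ).IsHyperbolic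

/-! ### The compactification of the hyperbolic plane

The closed disk `ℍ ∪ ∂ℍ` is viewed inside the Riemann sphere `ℂ ∪ {∞}`, with `∂ℍ = ℝ ∪ {∞}`. -/

/-- The inclusion of the hyperbolic plane in the Riemann sphere. -/
def toSphere (z : ℍ) : OnePoint ℂ := ((z : ℂ) : OnePoint ℂ)

/-- The inclusion of the ideal boundary in the Riemann sphere. -/
def idealToSphere (ξ : OnePoint ℝ) : OnePoint ℂ := OnePoint.map (fun x : ℝ => (x : ℂ)) ξ

/-- `ξ` is the attracting fixed point of the hyperbolic element `h`: it is fixed by `h` and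
all forward orbits in `ℍ` converge to it. -/
def IsAttractingFixedPoint (h : G₀) (ξ : OnePoint ℝ) : Prop :=
  h • ξ = ξ ∧
    ∀ z : ℍ, Filter.Tendsto (fun n : ℕ => toSphere (h ^ n • z)) Filter.atTop (𝓝 (idealToSphere ξ))

/-! ### Geodesic lines -/

/-- `γ` is a unit-speed parametrization of the geodesic line `L`. -/
def IsParametrization (γ : ℝ → ℍ) (L : Set ℍ) : Prop :=
  Isometry γ ∧ Set.range γ = L

/-- `L` is a geodesic line of the hyperbolic plane. -/
def IsGeodesicLine (L : Set ℍ) : Prop :=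
  ∃ γ : ℝ → ℍ, IsParametrization γ L

/-- `ξ` is an endpoint at infinity of the line `L`, that is, an ideal point of its closure. -/
def IsEndpoint (L : Set ℍ) (ξ : OnePoint ℝ) : Prop :=
  idealToSphere ξ ∈ closure (toSphere '' L)

/-- The geodesic lines `A` and `L` meet at a right angle. Angles are measured in `ℂ`, the
hyperbolic metric of the upper half-plane being conformal to the Euclidean one. -/
def IsOrthogonal (A L : Set ℍ) : Prop :=
  ∃ (γ δ : ℝ → ℍ) (v w : ℂ), IsParametrization γ A ∧ IsParametrization δ L ∧ γ 0 = δ 0 ∧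
    HasDerivAt (fun t => (γ t : ℂ)) v 0 ∧ HasDerivAt (fun t => (δ t : ℂ)) w 0 ∧ inner ℝ v w = 0

/-- `P` is one of the two sides of the line `L`. A transverse orientation of `L` is the choice of
one of its two sides, called the positive side. -/
def IsSide (L P : Set ℍ) : Prop :=
  ∃ z ∈ Lᶜ, P = connectedComponentIn Lᶜ z

/-- Disjoint lines with positive sides `P` and `P'` are transversely oriented away from each other
when these positive sides are disjoint. -/
def AwayFromEachOther (P P' : Set ℍ) : Prop :=
  Disjoint P P'

/-- `A` is the axis of the hyperbolic element `h`: the geodesic line preserved by `h`. -/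
def IsAxis (h : G₀) (A : Set ℍ) : Prop :=
  IsGeodesicLine A ∧ h • A = A

/-! ### AdS crooked planes and stem quadrants -/

/-- The stem of the crooked planes centered at the identity associated with `L`: the identity, the
elliptic elements with fixed point on `L`, and the parabolic elements fixing an endpoint of `L`. -/
def stem (L : Set ℍ) : Set G₀ :=
  {h | IsElliptic h ∧ ∃ p ∈ L, h • p = p} ∪ {1} ∪
    {h | IsParabolic h ∧ ∃ ξ : OnePoint ℝ, IsEndpoint L ξ ∧ h • ξ = ξ}

/-- The wing at `ξ`: the hyperbolic elements with attracting fixed point `ξ`. -/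
def wing (ξ : OnePoint ℝ) : Set G₀ :=
  {h | IsHyperbolic h ∧ IsAttractingFixedPoint h ξ}

/-- The left AdS crooked plane centered at the identity associated with `L`. -/
def leftCrookedPlane (L : Set ℍ) : Set G₀ :=
  stem L ∪ {h | ∃ ξ : OnePoint ℝ, IsEndpoint L ξ ∧ h ∈ wing ξ}

/-- The right AdS crooked plane centered at the identity associated with `L`. -/
def rightCrookedPlane (L : Set ℍ) : Set G₀ :=
  (leftCrookedPlane L)⁻¹

/-- The stem quadrant of the line `L` with positive side `P`: the hyperbolic elements whose axis is
orthogonal to `L` and which translate towards `P`, that is, which move the intersection point of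
the axis with `L` into `P`. -/
def stemQuadrant (L P : Set ℍ) : Set G₀ :=
  {h | IsHyperbolic h ∧
    ∃ A : Set ℍ, IsAxis h A ∧ IsOrthogonal A L ∧ ∃ p ∈ A ∩ L, h • p ∈ P}

end AdSCrooked

open AdSCrooked

namespace AdSCrooked

/-! ### Crooked planes in matrix form -/

/-! Everything reduces to inequalities between the entries of two real matrices. Write `ℓ` and `ℓ'`
as the images of the imaginary axis under `x` and `y`, and let `V` and `U` lift `x⁻¹y` and
`x⁻¹(g⁻¹g')y`. A common point of the two right crooked planes is the same as a solution of `m * U =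
V * M` with `m`, `M` in the left crooked plane of the imaginary axis
(`disjoint_rightCrookedPlane_iff`), and membership in that plane is an explicit condition on entries
(`mem_leftCrookedPlane_imAxis_iff`). Once `V` has positive entries, disjointness is equivalent to
`|U i j| < V i j` for all `i`, `j`.

Necessity of these inequalities comes from testing suitable elements, mostly triangular ones
(`CrookedDisjoint.abs_lt`). They force the product of the entries of `V` to be positive, so
half-turns preserving the axis make `V` positive and the lines disjoint. Solving a linear system
then gives `±U = K * V * K'` with `K`, `K'` in the quadrant of the imaginary axis
(`exists_factorization`), which is condition (D).

Sufficiency (`crookedDisjoint_of_abs_lt`) is a case analysis on stems and wings: stem elements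
preserve a semidefinite quadratic form, and wing elements expand a coordinate. To reach the
inequalities from (D), the orientations of the two lines and of their images under `g` and `g'`
provide lifts `V` and `U` with nonnegative entries. Inverses of quadrant elements have positive
entries and diagonal greater than 1, so `V = K⁻¹ * U * K'⁻¹` dominates `U` strictly
(`InQuadrant.abs_lt`). -/

lemma sl_ext {A B : SL(2, ℝ)} (h₀₀ : A 0 0 = B 0 0) (h₀₁ : A 0 1 = B 0 1)
    (h₁₀ : A 1 0 = B 1 0) (h₁₁ : A 1 1 = B 1 1) : A = B := by
  ext i j
  fin_cases i <;> fin_cases j <;> assumption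

lemma sl_det (A : SL(2, ℝ)) : A 0 0 * A 1 1 - A 0 1 * A 1 0 = 1 := by
  have := A.2
  rwa [Matrix.det_fin_two] at this

lemma sl_mul_apply (A B : SL(2, ℝ)) (i j : Fin 2) :
    (A * B) i j = A i 0 * B 0 j + A i 1 * B 1 j := by
  change (A.1 * B.1) i j = _
  rw [Matrix.mul_apply, Fin.sum_univ_two]

lemma sl_neg_apply (A : SL(2, ℝ)) (i j : Fin 2) : (-A) i j = -A i j := rfl

lemma sl_inv_apply (A : SL(2, ℝ)) :
    A⁻¹ 0 0 = A 1 1 ∧ A⁻¹ 0 1 = -A 0 1 ∧ A⁻¹ 1 0 = -A 1 0 ∧ A⁻¹ 1 1 = A 0 0 := by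
  refine ⟨?_, ?_, ?_, ?_⟩ <;>
    rw [Matrix.SpecialLinearGroup.SL2_inv_expl] <;> simp

/-- The matrix of determinant one with the given entries. -/
def slMk (a b c d : ℝ) (h : a * d - b * c = 1) : SL(2, ℝ) :=
  ⟨!![a, b; c, d], by rw [Matrix.det_fin_two_of, h]⟩

lemma slMk_apply (a b c d : ℝ) (h : a * d - b * c = 1) :
    slMk a b c d h 0 0 = a ∧ slMk a b c d h 0 1 = b ∧
      slMk a b c d h 1 0 = c ∧ slMk a b c d h 1 1 = d := by
  refine ⟨?_, ?_, ?_, ?_⟩ <;> simp [slMk]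

/-- The rotation by a half-turn about `i`. -/
def halfTurn : SL(2, ℝ) := slMk 0 (-1) 1 0 (by norm_num)

lemma halfTurn_apply :
    halfTurn 0 0 = 0 ∧ halfTurn 0 1 = -1 ∧ halfTurn 1 0 = 1 ∧ halfTurn 1 1 = 0 :=
  slMk_apply _ _ _ _ _

/-- The matrices representing elements of the left crooked plane of the imaginary axis. -/
def InCrooked (m : SL(2, ℝ)) : Prop :=
  (m 0 0 = m 1 1 ∧ m 0 1 * m 1 0 ≤ 0) ∨ (m 1 0 = 0 ∧ m 1 1 ^ 2 ≤ m 0 0 ^ 2) ∨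
    (m 0 1 = 0 ∧ m 0 0 ^ 2 ≤ m 1 1 ^ 2)

lemma InCrooked.neg {m : SL(2, ℝ)} (h : InCrooked m) : InCrooked (-m) := by
  unfold InCrooked at *
  simp only [sl_neg_apply]
  simpa using h

lemma inCrooked_one : InCrooked 1 := Or.inl (by simp)

lemma inCrooked_of_attracting {m : SL(2, ℝ)} (h : m 1 0 = 0) (h1 : 1 ≤ m 0 0 ^ 2) :
    InCrooked m := by
  refine Or.inr (Or.inl ⟨h, ?_⟩)
  have hd := sl_det m
  rw [h, mul_zero, sub_zero] at hd
  have : m 0 0 ^ 2 * m 1 1 ^ 2 = 1 := by rw [← mul_pow, hd, one_pow]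
  nlinarith [sq_nonneg (m 1 1)]

lemma InCrooked.conj_halfTurn {m : SL(2, ℝ)} (h : InCrooked m) :
    InCrooked (halfTurn * m * halfTurn⁻¹) := by
  obtain ⟨h1, h2, h3, h4⟩ := halfTurn_apply
  obtain ⟨i1, i2, i3, i4⟩ := sl_inv_apply halfTurn
  unfold InCrooked at *
  simp only [sl_mul_apply, h1, h2, h3, h4, i1, i2, i3, i4]
  rcases h with ⟨h, h'⟩ | ⟨h, h'⟩ | ⟨h, h'⟩
  · exact Or.inl ⟨by linarith, by linarith⟩
  · exact Or.inr (Or.inr ⟨by linarith, by linarith⟩)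
  · exact Or.inr (Or.inl ⟨by linarith, by linarith⟩)

lemma InCrooked.conj_inv_halfTurn {m : SL(2, ℝ)} (h : InCrooked m) :
    InCrooked (halfTurn⁻¹ * m * halfTurn) := by
  obtain ⟨h1, h2, h3, h4⟩ := halfTurn_apply
  obtain ⟨i1, i2, i3, i4⟩ := sl_inv_apply halfTurn
  unfold InCrooked at *
  simp only [sl_mul_apply, h1, h2, h3, h4, i1, i2, i3, i4]
  rcases h with ⟨h, h'⟩ | ⟨h, h'⟩ | ⟨h, h'⟩
  · exact Or.inl ⟨by linarith, by linarith⟩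
  · exact Or.inr (Or.inr ⟨by linarith, by linarith⟩)
  · exact Or.inr (Or.inl ⟨by linarith, by linarith⟩)

/-- No `m`, `M` in the crooked plane of the imaginary axis satisfy `m * U = V * M`. -/
def CrookedDisjoint (U V : SL(2, ℝ)) : Prop :=
  ∀ m M : SL(2, ℝ), InCrooked m → InCrooked M → m * U ≠ V * M

lemma CrookedDisjoint.halfTurn_left {U V : SL(2, ℝ)} (h : CrookedDisjoint U V) :
    CrookedDisjoint (halfTurn * U) (halfTurn * V) := fun m M hm hM e =>
  h _ M hm.conj_inv_halfTurn hM (by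
    rw [mul_assoc, mul_assoc, e, mul_assoc, inv_mul_cancel_left])

lemma CrookedDisjoint.halfTurn_right {U V : SL(2, ℝ)} (h : CrookedDisjoint U V) :
    CrookedDisjoint (U * halfTurn) (V * halfTurn) := fun m M hm hM e =>
  h m _ hm hM.conj_halfTurn (by
    rw [← mul_assoc, ← mul_assoc, ← e, ← mul_assoc, mul_inv_cancel_right])

/-! ### Entrywise inequalities forced by disjointness -/

lemma CrookedDisjoint.not_inCrooked {U V : SL(2, ℝ)} (H : CrookedDisjoint U V) {m : SL(2, ℝ)}
    (hm : InCrooked m) : ¬ InCrooked (V⁻¹ * m * U) := fun hM =>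
  H m _ hm hM (by group)

/-- With both matrices upper triangular, either `m = 1` or `M = 1` yields a solution: the leading
entries of `V⁻¹ * U` and `V * U⁻¹` have product 1, so one of them has absolute value at least 1. -/
lemma CrookedDisjoint.false_of_zero_zero {U V : SL(2, ℝ)} (H : CrookedDisjoint U V)
    (hq : V 1 0 = 0) (hb : U 1 0 = 0) : False := by
  have dU := sl_det U
  have dV := sl_det V
  obtain ⟨i1, i2, i3, i4⟩ := sl_inv_apply V
  obtain ⟨j1, j2, j3, j4⟩ := sl_inv_apply U
  rcases le_total (1 : ℝ) ((V⁻¹ * U) 0 0 ^ 2) with h1 | h1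
  · refine H.not_inCrooked inCrooked_one ?_
    rw [mul_one]
    exact inCrooked_of_attracting (by simp [sl_mul_apply, i3, hq, hb]) h1
  · refine H (V * U⁻¹) 1 ?_ inCrooked_one (by group)
    have h2 : (V * U⁻¹) 0 0 = V 0 0 * U 1 1 := by simp [sl_mul_apply, j1, j3, hb]
    have h3 : (V⁻¹ * U) 0 0 = V 1 1 * U 0 0 := by simp [sl_mul_apply, i1, i2, hb]
    refine inCrooked_of_attracting (by simp [sl_mul_apply, j3, hq, hb]) ?_
    rw [h2]
    rw [h3] at h1
    rw [hq] at dV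
    rw [hb] at dU
    have : (V 0 0 * U 1 1) ^ 2 * (V 1 1 * U 0 0) ^ 2 = 1 := by
      calc _ = (V 0 0 * V 1 1) ^ 2 * (U 0 0 * U 1 1) ^ 2 := by ring
        _ = 1 := by
          rw [show V 0 0 * V 1 1 = 1 by linarith, show U 0 0 * U 1 1 = 1 by linarith]; norm_num
    nlinarith [sq_nonneg (V 0 0 * U 1 1)]

/-- A wing element `m = (l, μ; 0, l⁻¹)` is sent into the stem: `μ` equalizes the diagonal entries of
`V⁻¹ * m * U`, and `l` is large enough for their product to be at most 1, which makes the
off-diagonal product nonpositive. -/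
lemma CrookedDisjoint.false_of_zero_ne {U V : SL(2, ℝ)} (H : CrookedDisjoint U V)
    (hq : V 1 0 = 0) (hb : U 1 0 ≠ 0) : False := by
  have dU := sl_det U
  have dV := sl_det V
  obtain ⟨i1, i2, i3, i4⟩ := sl_inv_apply V
  obtain ⟨l, hl⟩ : ∃ l : ℝ, l = 1 + |V 0 0 * U 1 1| := ⟨_, rfl⟩
  have l1 : 1 ≤ l := by rw [hl]; linarith [abs_nonneg (V 0 0 * U 1 1)]
  have l0 : l ≠ 0 := by positivity
  have hq2 : V 1 1 ≠ 0 := fun h => by simp [h, hq] at dV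
  obtain ⟨μ, hμ⟩ : ∃ μ : ℝ,
      l * U 0 0 + μ * U 1 0 = (V 0 0 * U 1 1 + V 0 1 * U 1 0) / (l * V 1 1) :=
    ⟨((V 0 0 * U 1 1 + V 0 1 * U 1 0) / (l * V 1 1) - l * U 0 0) / U 1 0, by
      rw [div_mul_cancel₀ _ hb]; ring⟩
  have hdet : l * l⁻¹ - μ * 0 = 1 := by rw [mul_inv_cancel₀ l0]; ring
  obtain ⟨m1, m2, m3, m4⟩ := slMk_apply l μ 0 l⁻¹ hdet
  obtain ⟨m, hm⟩ : ∃ m, m = slMk l μ 0 l⁻¹ hdet := ⟨_, rfl⟩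
  rw [← hm] at m1 m2 m3 m4
  refine H.not_inCrooked (m := m)
    (inCrooked_of_attracting m3 (by rw [m1]; exact one_le_pow₀ l1)) ?_
  have e11 : (V⁻¹ * m * U) 1 1 = V 0 0 * U 1 1 / l := by
    simp only [sl_mul_apply, i3, i4, m1, m2, m3, m4, hq]
    field_simp
    ring
  have e00 : (V⁻¹ * m * U) 0 0 = V 0 0 * U 1 1 / l := by
    have : (V⁻¹ * m * U) 0 0 = V 1 1 * (l * U 0 0 + μ * U 1 0) - V 0 1 * l⁻¹ * U 1 0 := by
      simp only [sl_mul_apply, i1, i2, m1, m2, m3, m4]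
      ring
    rw [this, hμ]
    field_simp
    ring
  have hd := sl_det (V⁻¹ * m * U)
  refine Or.inl ⟨by rw [e00, e11], ?_⟩
  have hle : (V 0 0 * U 1 1 / l) * (V 0 0 * U 1 1 / l) ≤ 1 := by
    rw [← sq, sq_le_one_iff_abs_le_one, abs_div, abs_of_pos (by linarith : 0 < l),
      div_le_one (by linarith)]
    linarith
  rw [e00, e11] at hd
  linarith

lemma CrookedDisjoint.abs_lt_one_zero {U V : SL(2, ℝ)} (H : CrookedDisjoint U V) :
    |U 1 0| < |V 1 0| := by
  by_contra hlt
  push Not at hlt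
  have dV := sl_det V
  obtain ⟨i1, i2, i3, i4⟩ := sl_inv_apply V
  have hq : V 1 0 ≠ 0 := fun hq => (em (U 1 0 = 0)).elim
    (fun hb => H.false_of_zero_zero hq hb) (fun hb => H.false_of_zero_ne hq hb)
  have hb : U 1 0 ≠ 0 := fun h => by
    rw [h, abs_zero] at hlt
    exact hq (abs_nonpos_iff.1 hlt)
  -- This translation length makes `V⁻¹ * m * U` upper triangular with leading entry `U 1 0 / V 1
  -- 0`, of absolute value at least 1.
  obtain ⟨μ, hμ⟩ : ∃ μ : ℝ, U 0 0 + μ * U 1 0 = U 1 0 / V 1 0 * V 0 0 :=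
    ⟨(U 1 0 / V 1 0 * V 0 0 - U 0 0) / U 1 0, by rw [div_mul_cancel₀ _ hb]; ring⟩
  have hdet : 1 * 1 - μ * 0 = 1 := by ring
  obtain ⟨m1, m2, m3, m4⟩ := slMk_apply 1 μ 0 1 hdet
  obtain ⟨m, hm⟩ : ∃ m, m = slMk 1 μ 0 1 hdet := ⟨_, rfl⟩
  rw [← hm] at m1 m2 m3 m4
  refine H.not_inCrooked (m := m) (inCrooked_of_attracting m3 (by rw [m1]; norm_num))
    (inCrooked_of_attracting ?_ ?_)
  · have : (V⁻¹ * m * U) 1 0 = -(V 1 0 * (U 0 0 + μ * U 1 0)) + V 0 0 * U 1 0 := by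
      simp only [sl_mul_apply, i3, i4, m1, m2, m3, m4]
      ring
    rw [this, hμ]
    field_simp
    ring
  · have e00 : (V⁻¹ * m * U) 0 0 = U 1 0 / V 1 0 := by
      have : (V⁻¹ * m * U) 0 0 = V 1 1 * (U 0 0 + μ * U 1 0) - V 0 1 * U 1 0 := by
        simp only [sl_mul_apply, i1, i2, m1, m2, m3, m4]
        ring
      rw [this, hμ]
      field_simp
      linear_combination dV
    rw [e00, one_le_sq_iff_one_le_abs, abs_div, one_le_div (abs_pos.2 hq)]
    exact hlt

/-- Multiplication by half-turns permutes the entries of `U` and `V` simultaneously, up to sign, so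
the bound on the lower left entry gives the other three. -/
lemma CrookedDisjoint.abs_lt {U V : SL(2, ℝ)} (H : CrookedDisjoint U V) (i j : Fin 2) :
    |U i j| < |V i j| := by
  obtain ⟨h1, h2, h3, h4⟩ := halfTurn_apply
  fin_cases i <;> fin_cases j <;> simp only [Fin.zero_eta, Fin.mk_one, Fin.isValue]
  · simpa [sl_mul_apply, h1, h2, h3, h4] using H.halfTurn_left.abs_lt_one_zero
  · simpa [sl_mul_apply, h1, h2, h3, h4] using H.halfTurn_left.halfTurn_right.abs_lt_one_zero
  · exact H.abs_lt_one_zero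
  · simpa [sl_mul_apply, h1, h2, h3, h4] using H.halfTurn_right.abs_lt_one_zero

/-- The sign says that the endpoints `V 0 0 / V 1 0` and `V 0 1 / V 1 1` of the image of the
imaginary axis lie strictly on the same side of 0. If the two products in `det V = 1` had opposite
signs, their absolute values would add up to 1, and the strictly smaller products of `U` could not
have difference 1. -/
lemma CrookedDisjoint.entries_pos {U V : SL(2, ℝ)} (H : CrookedDisjoint U V) :
    0 < V 0 0 * V 1 0 * (V 0 1 * V 1 1) := by
  have dU := sl_det U
  have dV := sl_det V
  have ne : ∀ i j, V i j ≠ 0 := fun i j h => by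
    have := H.abs_lt i j
    rw [h, abs_zero] at this
    exact absurd this (not_lt.2 (abs_nonneg _))
  have hne : V 0 0 * V 1 0 * (V 0 1 * V 1 1) ≠ 0 := by simp [ne]
  by_contra hneg
  have hlt := lt_of_le_of_ne (not_lt.1 hneg) hne
  have a1 : |U 0 0 * U 1 1| < |V 0 0 * V 1 1| := by
    rw [abs_mul, abs_mul]
    exact mul_lt_mul'' (H.abs_lt _ _) (H.abs_lt _ _) (abs_nonneg _) (abs_nonneg _)
  have a2 : |U 0 1 * U 1 0| < |V 0 1 * V 1 0| := by
    rw [abs_mul, abs_mul]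
    exact mul_lt_mul'' (H.abs_lt _ _) (H.abs_lt _ _) (abs_nonneg _) (abs_nonneg _)
  have hprod : (V 0 0 * V 1 1) * (V 0 1 * V 1 0) < 0 := by linarith
  rcases mul_neg_iff.1 hprod with ⟨h1, h2⟩ | ⟨h1, h2⟩
  · rw [abs_of_pos h1] at a1
    rw [abs_of_neg h2] at a2
    linarith [le_abs_self (U 0 0 * U 1 1), neg_abs_le (U 0 1 * U 1 0)]
  · linarith

/-! ### A sufficient condition for disjointness -/

/-- The map `(x, y) ↦ (x', y')` preserves the form `γx² + βy²`, which is semidefinite, so it cannot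
shrink both coordinates. If `γ = 0` the form may carry no information, but then `s² = 1` and `y' =
±y`. -/
lemma not_rotation_of_sq_lt {s β γ x y x' y' : ℝ} (hβγ : 0 ≤ β * γ) (hs : s ^ 2 + β * γ = 1)
    (hx : x' = s * x + β * y) (hy : y' = s * y - γ * x) (hx' : x' ^ 2 < x ^ 2)
    (hy' : y' ^ 2 < y ^ 2) : False := by
  have key : γ * x' ^ 2 + β * y' ^ 2 = γ * x ^ 2 + β * y ^ 2 := by
    rw [hx, hy]
    linear_combination (γ * x ^ 2 + β * y ^ 2) * hs
  have key' : γ * (x ^ 2 - x' ^ 2) + β * (y ^ 2 - y' ^ 2) = 0 := by linarith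
  have d1 : 0 < x ^ 2 - x' ^ 2 := by linarith
  have d2 : 0 < y ^ 2 - y' ^ 2 := by linarith
  have hγ0 : γ = 0 := by
    by_contra hγ
    have h1 : 0 < γ ^ 2 * (x ^ 2 - x' ^ 2) := by positivity
    have h2 : 0 ≤ β * γ * (y ^ 2 - y' ^ 2) := by positivity
    have h3 : γ * (γ * (x ^ 2 - x' ^ 2) + β * (y ^ 2 - y' ^ 2)) = 0 := by rw [key', mul_zero]
    linarith
  rw [hγ0, mul_zero, add_zero] at hs
  rw [hy, hγ0, zero_mul, sub_zero, mul_pow, hs, one_mul] at hy'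
  exact lt_irrefl _ hy'

lemma mul_mul_sub_pos {s t F G : ℝ} (hs : s ≠ 0) (hst : |t| ≤ |s|) (h : |G| < F) :
    0 < s * (s * F - t * G) := by
  have h1 : s * t * G ≤ s ^ 2 * |G| := by
    calc s * t * G ≤ |s * t * G| := le_abs_self _
      _ = |s| * |t| * |G| := by rw [abs_mul, abs_mul]
      _ ≤ |s| * |s| * |G| := by gcongr
      _ = s ^ 2 * |G| := by rw [← sq, sq_abs]
  have h2 : s ^ 2 * |G| < s ^ 2 * F := by
    have : 0 < s ^ 2 := by positivity
    exact mul_lt_mul_of_pos_left h this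
  linarith

lemma mul_pos_of_dominant {s t F G F' G' : ℝ} (hs : s ≠ 0) (hst : |t| ≤ |s|) (h : |G| < F)
    (h' : |G'| < F') : 0 < (s * F - t * G) * (s * F' - t * G') := by
  have h1 := mul_pos (mul_mul_sub_pos hs hst h) (mul_mul_sub_pos hs hst h')
  have h2 : 0 < s ^ 2 * ((s * F - t * G) * (s * F' - t * G')) := by linarith
  exact pos_of_mul_pos_right h2 (sq_nonneg s)

/-- Both bounds are positivity of `(p - a) * (q - b)` and `(p + a) * (q + b)`. -/
lemma abs_cross_lt {a b p q : ℝ} (ha : |a| < p) (hb : |b| < q) :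
    |b * p + a * q| < p * q + a * b := by
  obtain ⟨a1, a2⟩ := abs_lt.1 ha
  obtain ⟨b1, b2⟩ := abs_lt.1 hb
  rw [abs_lt]
  constructor <;> nlinarith

/-- Given the diagonal values `s` of `m` and `t` of `M`, the equation is linear in the four
off-diagonal entries. In its solution, the entries of the matrix with the larger diagonal are
dominated by a term of the same sign, so their product is positive, contrary to the stem condition.
-/
lemma stem_stem_ne {U V : SL(2, ℝ)} (h : ∀ i j, |U i j| < V i j) {m M : SL(2, ℝ)}
    (hm : m 0 0 = m 1 1) (hm' : m 0 1 * m 1 0 ≤ 0) (hM : M 0 0 = M 1 1)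
    (hM' : M 0 1 * M 1 0 ≤ 0) : m * U ≠ V * M := by
  intro e
  have dU := sl_det U
  have dV := sl_det V
  have dm := sl_det m
  have dM := sl_det M
  have ent : ∀ i j, m i 0 * U 0 j + m i 1 * U 1 j = V i 0 * M 0 j + V i 1 * M 1 j := fun i j => by
    rw [← sl_mul_apply, e, sl_mul_apply]
  have e00 := ent 0 0
  have e01 := ent 0 1
  have e10 := ent 1 0
  have e11 := ent 1 1
  clear e ent
  have hE : 0 < V 0 1 * V 1 0 - U 0 1 * U 1 0 := by
    have : |U 0 1 * U 1 0| < V 0 1 * V 1 0 := by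
      rw [abs_mul]
      exact mul_lt_mul'' (h _ _) (h _ _) (abs_nonneg _) (abs_nonneg _)
    linarith [le_abs_self (U 0 1 * U 1 0)]
  have f1 := abs_cross_lt (h 0 0) (h 0 1)
  have f2 := abs_cross_lt (h 1 0) (h 1 1)
  have f3 := abs_cross_lt (h 0 0) (h 1 0)
  have f4 := abs_cross_lt (h 0 1) (h 1 1)
  generalize U 0 0 = a1, U 0 1 = a2, U 1 0 = b1, U 1 1 = b2, V 0 0 = p1, V 0 1 = p2,
    V 1 0 = q1, V 1 1 = q2, m 0 1 = mb, m 1 0 = mc, M 0 1 = Mb, M 1 0 = Mc at *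
  rw [hm] at dm e00 e01
  rw [hM] at dM e00 e10
  generalize m 1 1 = s, M 1 1 = t at *
  -- Solution of the linear system. The common denominator `p2 * q1 - a2 * b1` also equals `p1 * q2
  -- - a1 * b2`, since both determinants are 1.
  have hb : mb * (p2 * q1 - a2 * b1) = s * (p1 * p2 + a1 * a2) - t * (a2 * p1 + a1 * p2) := by
    linear_combination (-a2 * p1) * (q2 * e00 - p2 * e10) + a1 * p2 * (q1 * e01 - p1 * e11) +
      (s * a1 * a2 + t * (-a2 * p1 - a1 * p2)) * dV + s * p1 * p2 * dU -
        mb * (p2 * q1 * dU - a2 * b1 * dV)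
  have hc : mc * (p2 * q1 - a2 * b1) = s * (q1 * q2 + b1 * b2) - t * (b2 * q1 + b1 * q2) := by
    linear_combination (-b2 * q1) * (q2 * e00 - p2 * e10) + b1 * q2 * (q1 * e01 - p1 * e11) +
      (s * b1 * b2 + t * (-b2 * q1 - b1 * q2)) * dV + s * q1 * q2 * dU -
        mc * (p2 * q1 * dU - a2 * b1 * dV)
  have hβ : -Mc * (p2 * q1 - a2 * b1) = t * (p1 * q1 + a1 * b1) - s * (b1 * p1 + a1 * q1) := by
    linear_combination (a1 * q1) * (b2 * e00 - b1 * e01) - b1 * p1 * (a2 * e10 - a1 * e11) +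
      (t * a1 * b1) * dV + (t * p1 * q1 + s * (-a1 * q1 - b1 * p1)) * dU +
        Mc * (p2 * q1 * dU - a2 * b1 * dV)
  have hγ : -Mb * (p2 * q1 - a2 * b1) = t * (p2 * q2 + a2 * b2) - s * (b2 * p2 + a2 * q2) := by
    linear_combination (a2 * q2) * (b2 * e00 - b1 * e01) - b2 * p2 * (a2 * e10 - a1 * e11) +
      (t * a2 * b2) * dV + (t * p2 * q2 + s * (-a2 * q2 - b2 * p2)) * dU +
        Mb * (p2 * q1 * dU - a2 * b1 * dV)
  have hE2 : 0 < (p2 * q1 - a2 * b1) ^ 2 := by positivity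
  rcases le_total |t| |s| with hst | hst
  · have hs : s ≠ 0 := by
      rintro rfl
      rw [abs_zero] at hst
      have ht : t = 0 := abs_nonpos_iff.1 hst
      subst ht
      have hb0 : mb = 0 := by
        simpa [hE.ne'] using hb
      rw [hb0] at dm
      norm_num at dm
    have := mul_pos_of_dominant hs hst f1 f2
    rw [← hb, ← hc] at this
    nlinarith
  · have ht : t ≠ 0 := by
      rintro rfl
      rw [abs_zero] at hst
      have hs : s = 0 := abs_nonpos_iff.1 hst
      subst hs
      have hb0 : mb = 0 := by
        simpa [hE.ne'] using hb
      rw [hb0] at dm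
      norm_num at dm
    have := mul_pos_of_dominant ht hst f3 f4
    rw [← hβ, ← hγ] at this
    nlinarith

lemma sq_mul_lt {t u v : ℝ} (ht : t ^ 2 ≤ 1) (h : |u| < v) : (t * u) ^ 2 < v ^ 2 := by
  have h1 : u ^ 2 < v ^ 2 := sq_lt_sq' (abs_lt.1 h).1 (abs_lt.1 h).2
  rw [mul_pow]
  nlinarith [sq_nonneg u]

lemma sq_le_one_of_mul_eq_one {x y : ℝ} (h : x * y = 1) (hle : y ^ 2 ≤ x ^ 2) :
    y ^ 2 ≤ 1 ∧ 1 ≤ x ^ 2 := by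
  have h1 : x ^ 2 * y ^ 2 = 1 := by rw [← mul_pow, h, one_pow]
  constructor <;> nlinarith [sq_nonneg x, sq_nonneg y]

/-- This treats `m` in a wing: the row of `m * U` that only involves the contracting entry `t` of
`m` is `t` times a row of `U`. Hence `M` shrinks both coordinates of the row `(v₀, v₁)`, whereas a
stem element preserves a semidefinite form and a wing element does not shrink its attracting
coordinate. -/
lemma not_inCrooked_of_row {t u₀ u₁ v₀ v₁ : ℝ} (ht : t ^ 2 ≤ 1) (h₀ : |u₀| < v₀) (h₁ : |u₁| < v₁)
    {M : SL(2, ℝ)} (e₀ : t * u₀ = v₀ * M 0 0 + v₁ * M 1 0)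
    (e₁ : t * u₁ = v₀ * M 0 1 + v₁ * M 1 1) : ¬ InCrooked M := by
  have d := sl_det M
  have s₀ := sq_mul_lt ht h₀
  have s₁ := sq_mul_lt ht h₁
  rintro (⟨hM, hM'⟩ | ⟨hM, hM'⟩ | ⟨hM, hM'⟩)
  · refine not_rotation_of_sq_lt (s := M 0 0) (β := M 1 0) (γ := -M 0 1) (by linarith) ?_
      (e₀.trans (by ring)) (e₁.trans (by rw [hM]; ring)) s₀ s₁
    rw [← hM] at d
    linarith
  · rw [hM, mul_zero, sub_zero] at d
    have := (sq_le_one_of_mul_eq_one d hM').2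
    rw [e₀, hM, mul_zero, add_zero, mul_pow] at s₀
    nlinarith [sq_nonneg v₀]
  · rw [hM, zero_mul, sub_zero, mul_comm] at d
    have := (sq_le_one_of_mul_eq_one d hM').2
    rw [e₁, hM, mul_zero, zero_add, mul_pow] at s₁
    nlinarith [sq_nonneg v₁]

/-- This treats `M` in a wing: one column of `V * M` is a multiple of a column of `V`, and `t` is
the inverse of the factor. Then `m⁻¹` would shrink both coordinates of that column. -/
lemma stem_wing_false {t u₀ u₁ v₀ v₁ : ℝ} (ht : t ^ 2 ≤ 1) (h₀ : |u₀| < v₀) (h₁ : |u₁| < v₁)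
    {m : SL(2, ℝ)} (hm : m 0 0 = m 1 1) (hm' : m 0 1 * m 1 0 ≤ 0)
    (e₀ : t * (m 0 0 * u₀ + m 0 1 * u₁) = v₀) (e₁ : t * (m 1 0 * u₀ + m 1 1 * u₁) = v₁) :
    False := by
  have d := sl_det m
  rw [hm] at d e₀
  refine not_rotation_of_sq_lt (s := m 1 1) (β := -m 0 1) (γ := m 1 0) (by linarith)
    (by linarith) (?_ : t * u₀ = _) (?_ : t * u₁ = _) (sq_mul_lt ht h₀) (sq_mul_lt ht h₁)
  · rw [← e₀, ← e₁]
    linear_combination (-t * u₀) * d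
  · rw [← e₀, ← e₁]
    linear_combination (-t * u₁) * d

lemma crookedDisjoint_of_abs_lt {U V : SL(2, ℝ)} (h : ∀ i j, |U i j| < V i j) :
    CrookedDisjoint U V := by
  intro m M hm hM e
  have ent : ∀ i j, m i 0 * U 0 j + m i 1 * U 1 j = V i 0 * M 0 j + V i 1 * M 1 j := fun i j => by
    rw [← sl_mul_apply, e, sl_mul_apply]
  have dm := sl_det m
  have dM := sl_det M
  rcases hm with ⟨hm, hm'⟩ | ⟨hm, hm'⟩ | ⟨hm, hm'⟩
  · rcases hM with ⟨hM, hM'⟩ | ⟨hM, hM'⟩ | ⟨hM, hM'⟩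
    · exact stem_stem_ne h hm hm' hM hM' e
    · rw [hM, mul_zero, sub_zero] at dM
      refine stem_wing_false (sq_le_one_of_mul_eq_one dM hM').1 (h 0 0) (h 1 0) hm hm' ?_ ?_ <;>
      · rw [ent, hM]
        linear_combination (V _ 0) * dM
    · rw [hM, zero_mul, sub_zero, mul_comm] at dM
      refine stem_wing_false (sq_le_one_of_mul_eq_one dM hM').1 (h 0 1) (h 1 1) hm hm' ?_ ?_ <;>
      · rw [ent, hM]
        linear_combination (V _ 1) * dM
  · rw [hm, mul_zero, sub_zero] at dm
    have e0 := ent 1 0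
    have e1 := ent 1 1
    rw [hm, zero_mul, zero_add] at e0 e1
    exact not_inCrooked_of_row (sq_le_one_of_mul_eq_one dm hm').1 (h 1 0) (h 1 1) e0 e1 hM
  · rw [hm, zero_mul, sub_zero, mul_comm] at dm
    have e0 := ent 0 0
    have e1 := ent 0 1
    rw [hm, zero_mul, add_zero] at e0 e1
    exact not_inCrooked_of_row (sq_le_one_of_mul_eq_one dm hm').1 (h 0 0) (h 0 1) e0 e1 hM

/-! ### Stem quadrants in matrix form -/

/-- The matrices representing elements of the stem quadrant of the imaginary axis, for the
positive side `re < 0`. -/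
def InQuadrant (K : SL(2, ℝ)) : Prop :=
  0 < K 0 0 ∧ K 1 1 = K 0 0 ∧ K 0 1 < 0 ∧ K 1 0 < 0

lemma InQuadrant.one_lt {K : SL(2, ℝ)} (h : InQuadrant K) : 1 < K 0 0 := by
  obtain ⟨h1, h2, h3, h4⟩ := h
  have d := sl_det K
  rw [h2] at d
  nlinarith [mul_pos_of_neg_of_neg h3 h4]

/-- The coefficient of `u₀₀` exceeds 1 and the others are positive; `hne` keeps the inequality
strict when `u₀₀ = 0`. -/
lemma entry_lt {u₀₀ u₀₁ u₁₀ u₁₁ x y x' y' z : ℝ} (h₀₀ : 0 ≤ u₀₀) (h₀₁ : 0 ≤ u₀₁) (h₁₀ : 0 ≤ u₁₀)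
    (h₁₁ : 0 ≤ u₁₁) (hne : 0 < u₀₀ + u₀₁ + u₁₀ + u₁₁) (hx : 1 < x) (hy : 0 < y) (hx' : 1 < x')
    (hy' : 0 < y') (hz : z = x * x' * u₀₀ + x * y' * u₀₁ + y * x' * u₁₀ + y * y' * u₁₁) :
    |u₀₀| < z := by
  rw [abs_of_nonneg h₀₀, hz]
  have c0 : 0 < x * x' - 1 := by nlinarith
  have c1 : 0 < x * y' := by positivity
  have c2 : 0 < y * x' := by positivity
  have c3 : 0 < y * y' := by positivity
  by_contra hle
  have m0 := mul_nonneg c0.le h₀₀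
  have m1 := mul_nonneg c1.le h₀₁
  have m2 := mul_nonneg c2.le h₁₀
  have m3 := mul_nonneg c3.le h₁₁
  have z0 : u₀₀ = 0 := by
    have : (x * x' - 1) * u₀₀ = 0 := by linarith
    exact (mul_eq_zero.1 this).resolve_left c0.ne'
  have z1 : u₀₁ = 0 := by
    have : (x * y') * u₀₁ = 0 := by linarith
    exact (mul_eq_zero.1 this).resolve_left c1.ne'
  have z2 : u₁₀ = 0 := by
    have : (y * x') * u₁₀ = 0 := by linarith
    exact (mul_eq_zero.1 this).resolve_left c2.ne'
  have z3 : u₁₁ = 0 := by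
    have : (y * y') * u₁₁ = 0 := by linarith
    exact (mul_eq_zero.1 this).resolve_left c3.ne'
  linarith

/-- Multiplying on both sides by inverses of elements of the stem quadrant increases the entries of
a nonnegative matrix. -/
lemma InQuadrant.abs_lt {K K' U V : SL(2, ℝ)} (hK : InQuadrant K) (hK' : InQuadrant K')
    (hU : ∀ i j, 0 ≤ U i j) (h : U = K * V * K') (i j : Fin 2) : |U i j| < V i j := by
  -- Inversion makes the off-diagonal entries of quadrant elements positive, so each entry of `V` is
  -- a positive combination of those of `U`, to which `entry_lt` applies.
  have hV : V = K⁻¹ * U * K'⁻¹ := by rw [h]; group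
  obtain ⟨i1, i2, i3, i4⟩ := sl_inv_apply K
  obtain ⟨j1, j2, j3, j4⟩ := sl_inv_apply K'
  have dU := sl_det U
  have a := hK.one_lt
  have a' := hK'.one_lt
  obtain ⟨-, h2, h3, h4⟩ := hK
  obtain ⟨-, h2', h3', h4'⟩ := hK'
  have hne : 0 < U 0 0 + U 0 1 + U 1 0 + U 1 1 := by
    by_contra hle
    have h00 : U 0 0 = 0 := by linarith [hU 0 0, hU 0 1, hU 1 0, hU 1 1]
    have h01 : U 0 1 = 0 := by linarith [hU 0 0, hU 0 1, hU 1 0, hU 1 1]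
    rw [h00, h01] at dU
    norm_num at dU
  have n3 := neg_pos.2 h3
  have n4 := neg_pos.2 h4
  have n3' := neg_pos.2 h3'
  have n4' := neg_pos.2 h4'
  fin_cases i <;> fin_cases j <;> simp only [Fin.zero_eta, Fin.mk_one, Fin.isValue]
  · refine entry_lt (hU 0 0) (hU 0 1) (hU 1 0) (hU 1 1) (by linarith) a n3 a' n4' ?_
    rw [hV]
    simp only [sl_mul_apply, i1, i2, j1, j3, h2, h2']
    ring
  · refine entry_lt (hU 0 1) (hU 0 0) (hU 1 1) (hU 1 0) (by linarith) a n3 a' n3' ?_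
    rw [hV]
    simp only [sl_mul_apply, i1, i2, j2, j4, h2]
    ring
  · refine entry_lt (hU 1 0) (hU 1 1) (hU 0 0) (hU 0 1) (by linarith) a n4 a' n4' ?_
    rw [hV]
    simp only [sl_mul_apply, i3, i4, j1, j3, h2']
    ring
  · refine entry_lt (hU 1 1) (hU 1 0) (hU 0 1) (hU 0 0) (by linarith) a n4 a' n3' ?_
    rw [hV]
    simp only [sl_mul_apply, i3, i4, j2, j4]
    ring

/-- With `Q = K⁻¹`, the equation `Q * U = V * K'` is linear in `Q` and `K'`. Fixing their diagonals
to a common `r`, it determines the off-diagonal entries `r * b`, `r * c`, `-(r * γ)`, `-(r * β)`,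
whose signs follow from `U i j < V i j`. Normalizing the determinant requires `b * c < 1`, which is
the hypothesis `hlt`; both determinants agree because `γ * β = b * c`. -/
lemma exists_factorization_of_lt {U V : SL(2, ℝ)} (h : ∀ i j, |U i j| < V i j)
    (hlt : (V 0 0 - U 0 0) * (V 0 1 - U 0 1) * ((V 1 0 - U 1 0) * (V 1 1 - U 1 1)) <
      (V 0 1 * V 1 0 - U 0 1 * U 1 0) ^ 2) :
    ∃ K K', InQuadrant K ∧ InQuadrant K' ∧ U = K * V * K' := by
  have dU := sl_det U
  have dV := sl_det V
  have hE : 0 < V 0 1 * V 1 0 - U 0 1 * U 1 0 := by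
    have : |U 0 1 * U 1 0| < V 0 1 * V 1 0 := by
      rw [abs_mul]
      exact mul_lt_mul'' (h _ _) (h _ _) (abs_nonneg _) (abs_nonneg _)
    linarith [le_abs_self (U 0 1 * U 1 0)]
  have d00 : 0 < V 0 0 - U 0 0 := by linarith [h 0 0, le_abs_self (U 0 0)]
  have d01 : 0 < V 0 1 - U 0 1 := by linarith [h 0 1, le_abs_self (U 0 1)]
  have d10 : 0 < V 1 0 - U 1 0 := by linarith [h 1 0, le_abs_self (U 1 0)]
  have d11 : 0 < V 1 1 - U 1 1 := by linarith [h 1 1, le_abs_self (U 1 1)]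
  obtain ⟨E, hEE⟩ : ∃ E, E = V 0 1 * V 1 0 - U 0 1 * U 1 0 := ⟨_, rfl⟩
  rw [← hEE] at hE hlt
  obtain ⟨b, hb⟩ : ∃ b, b = (V 0 0 - U 0 0) * (V 0 1 - U 0 1) / E := ⟨_, rfl⟩
  obtain ⟨c, hc⟩ : ∃ c, c = (V 1 0 - U 1 0) * (V 1 1 - U 1 1) / E := ⟨_, rfl⟩
  obtain ⟨β, hβ⟩ : ∃ β, β = (V 0 0 - U 0 0) * (V 1 0 - U 1 0) / E := ⟨_, rfl⟩
  obtain ⟨γ, hγ⟩ : ∃ γ, γ = (V 0 1 - U 0 1) * (V 1 1 - U 1 1) / E := ⟨_, rfl⟩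
  have b0 : 0 < b := by rw [hb]; positivity
  have c0 : 0 < c := by rw [hc]; positivity
  have β0 : 0 < β := by rw [hβ]; positivity
  have γ0 : 0 < γ := by rw [hγ]; positivity
  have hbc : b * c < 1 := by
    rw [hb, hc, div_mul_div_comm, div_lt_one (by positivity), ← sq]
    exact hlt
  have hβγ : γ * β = b * c := by
    rw [hb, hc, hβ, hγ]
    ring
  obtain ⟨r, hr⟩ : ∃ r, r = (√(1 - b * c))⁻¹ := ⟨_, rfl⟩
  have r0 : 0 < r := by
    rw [hr]
    exact inv_pos.2 (Real.sqrt_pos.2 (by linarith))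
  have r2 : r ^ 2 * (1 - b * c) = 1 := by
    rw [hr, inv_pow, Real.sq_sqrt (by linarith), inv_mul_cancel₀ (by linarith)]
  have dQ : r * r - (r * b) * (r * c) = 1 := by linear_combination r2
  have dQ' : r * r - (-(r * γ)) * (-(r * β)) = 1 := by
    linear_combination r2 - r ^ 2 * hβγ
  obtain ⟨m1, m2, m3, m4⟩ := slMk_apply r (r * b) (r * c) r dQ
  obtain ⟨n1, n2, n3, n4⟩ := slMk_apply r (-(r * γ)) (-(r * β)) r dQ'
  obtain ⟨Q, hQ⟩ : ∃ Q, Q = slMk r (r * b) (r * c) r dQ := ⟨_, rfl⟩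
  obtain ⟨Q', hQ'⟩ : ∃ Q', Q' = slMk r (-(r * γ)) (-(r * β)) r dQ' := ⟨_, rfl⟩
  rw [← hQ] at m1 m2 m3 m4
  rw [← hQ'] at n1 n2 n3 n4
  obtain ⟨i1, i2, i3, i4⟩ := sl_inv_apply Q
  refine ⟨Q⁻¹, Q', ⟨?_, ?_, ?_, ?_⟩, ⟨?_, ?_, ?_, ?_⟩, ?_⟩
  · rw [i1, m4]; exact r0
  · rw [i1, i4, m1, m4]
  · rw [i2, m2]; exact neg_neg_of_pos (by positivity)
  · rw [i3, m3]; exact neg_neg_of_pos (by positivity)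
  · rw [n1]; exact r0
  · rw [n1, n4]
  · rw [n2]; exact neg_neg_of_pos (by positivity)
  · rw [n3]; exact neg_neg_of_pos (by positivity)
  have E0 := hE.ne'
  suffices Q * U = V * Q' by rw [mul_assoc, ← this, inv_mul_cancel_left]
  have hEE' : E = V 0 0 * V 1 1 - U 0 0 * U 1 1 := by rw [hEE]; linear_combination dU - dV
  apply sl_ext
  · rw [sl_mul_apply, sl_mul_apply, m1, m2, n1, n3, hb, hβ]
    field_simp
    rw [hEE]; ring
  · rw [sl_mul_apply, sl_mul_apply, m1, m2, n2, n4, hb, hγ]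
    field_simp
    rw [hEE']; ring
  · rw [sl_mul_apply, sl_mul_apply, m3, m4, n1, n3, hc, hβ]
    field_simp
    rw [hEE']; ring
  · rw [sl_mul_apply, sl_mul_apply, m3, m4, n2, n4, hc, hγ]
    field_simp
    rw [hEE]; ring

/-- If the criterion of `exists_factorization_of_lt` fails for both `U` and `-U`, multiplying the
two failures gives `E⁴ ≤ A * B`, while `A` and `B` are at most `E²`. Equality makes corresponding
entries of `U` and `V` proportional, with one ratio `x` on the diagonal and another `y` off it. The
failures then force `y = -x`, contradicting `det V = 1`. -/
lemma exists_factorization {U V : SL(2, ℝ)} (h : ∀ i j, |U i j| < V i j) :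
    ∃ K K', InQuadrant K ∧ InQuadrant K' ∧ (U = K * V * K' ∨ -U = K * V * K') := by
  by_cases h1 : (V 0 0 - U 0 0) * (V 0 1 - U 0 1) * ((V 1 0 - U 1 0) * (V 1 1 - U 1 1)) <
      (V 0 1 * V 1 0 - U 0 1 * U 1 0) ^ 2
  · obtain ⟨K, K', hK, hK', e⟩ := exists_factorization_of_lt h h1
    exact ⟨K, K', hK, hK', Or.inl e⟩
  by_cases h2 : (V 0 0 + U 0 0) * (V 0 1 + U 0 1) * ((V 1 0 + U 1 0) * (V 1 1 + U 1 1)) <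
      (V 0 1 * V 1 0 - U 0 1 * U 1 0) ^ 2
  · obtain ⟨K, K', hK, hK', e⟩ := exists_factorization_of_lt (U := -U) (V := V)
      (fun i j => by rw [sl_neg_apply, abs_neg]; exact h i j)
      (by simpa only [sl_neg_apply, sub_neg_eq_add, neg_mul_neg] using h2)
    exact ⟨K, K', hK, hK', Or.inr e⟩
  exfalso
  have dU := sl_det U
  have dV := sl_det V
  have pos : ∀ i j, 0 < V i j := fun i j => (abs_nonneg _).trans_lt (h i j)
  have dm : ∀ i j, 0 < V i j - U i j := fun i j => by linarith [h i j, le_abs_self (U i j)]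
  have dp : ∀ i j, 0 < V i j + U i j := fun i j => by linarith [h i j, neg_abs_le (U i j)]
  have p00 := pos 0 0
  have p01 := pos 0 1
  have p10 := pos 1 0
  have p11 := pos 1 1
  have m00 := dm 0 0
  have m01 := dm 0 1
  have m10 := dm 1 0
  have m11 := dm 1 1
  have s00 := dp 0 0
  have s01 := dp 0 1
  have s10 := dp 1 0
  have s11 := dp 1 1
  have hE : 0 < V 0 1 * V 1 0 - U 0 1 * U 1 0 := by
    have : |U 0 1 * U 1 0| < V 0 1 * V 1 0 := by
      rw [abs_mul]
      exact mul_lt_mul'' (h _ _) (h _ _) (abs_nonneg _) (abs_nonneg _)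
    linarith [le_abs_self (U 0 1 * U 1 0)]
  clear h pos dm dp
  generalize U 0 0 = a1, U 0 1 = a2, U 1 0 = b1, U 1 1 = b2, V 0 0 = p1, V 0 1 = p2,
    V 1 0 = q1, V 1 1 = q2 at *
  obtain ⟨E, hEE⟩ : ∃ E, E = p2 * q1 - a2 * b1 := ⟨_, rfl⟩
  have hEE' : E = p1 * q2 - a1 * b2 := by rw [hEE]; linear_combination dU - dV
  rw [← hEE] at h1 h2 hE
  push Not at h1 h2
  obtain ⟨A, hA⟩ : ∃ A, A = (p1 ^ 2 - a1 ^ 2) * (q2 ^ 2 - b2 ^ 2) := ⟨_, rfl⟩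
  obtain ⟨B, hB⟩ : ∃ B, B = (p2 ^ 2 - a2 ^ 2) * (q1 ^ 2 - b1 ^ 2) := ⟨_, rfl⟩
  have hA' : A = E ^ 2 - (p1 * b2 - a1 * q2) ^ 2 := by rw [hA, hEE']; ring
  have hB' : B = E ^ 2 - (p2 * b1 - a2 * q1) ^ 2 := by rw [hB, hEE]; ring
  have hAB : E ^ 2 * E ^ 2 ≤ A * B := by
    calc E ^ 2 * E ^ 2 ≤ _ := mul_le_mul h1 h2 (sq_nonneg E) (by positivity)
      _ = A * B := by rw [hA, hB]; ring
  have hA0 : 0 < A := by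
    rw [hA]
    have e1 : 0 < (p1 - a1) * (p1 + a1) := by positivity
    have e2 : 0 < (q2 - b2) * (q2 + b2) := by positivity
    nlinarith
  have E2 : 0 < E ^ 2 := by positivity
  have x0 : p1 * b2 - a1 * q2 = 0 := by
    have : A * B ≤ A * E ^ 2 := mul_le_mul_of_nonneg_left (by nlinarith) hA0.le
    have h3 : E ^ 2 ≤ A := le_of_mul_le_mul_right (hAB.trans this) E2
    exact pow_eq_zero_iff two_ne_zero |>.1 (le_antisymm (by linarith) (sq_nonneg _))
  have y0 : p2 * b1 - a2 * q1 = 0 := by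
    have hAE : A = E ^ 2 := by rw [hA', x0]; ring
    rw [hAE] at hAB
    have h3 : E ^ 2 ≤ B := le_of_mul_le_mul_left hAB E2
    exact pow_eq_zero_iff two_ne_zero |>.1 (le_antisymm (by linarith) (sq_nonneg _))
  obtain ⟨x, hx⟩ : ∃ x, a1 = x * p1 := ⟨a1 / p1, by field_simp⟩
  obtain ⟨y, hy⟩ : ∃ y, a2 = y * p2 := ⟨a2 / p2, by field_simp⟩
  have hb2 : b2 = x * q2 := by
    apply mul_left_cancel₀ p00.ne'
    rw [hx] at x0
    linear_combination x0
  have hb1 : b1 = y * q1 := by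
    apply mul_left_cancel₀ p01.ne'
    rw [hy] at y0
    linear_combination y0
  subst hx hy hb2 hb1
  have x1 : 0 < 1 - x := pos_of_mul_pos_left (by linarith : 0 < (1 - x) * p1) p00.le
  have x2 : 0 < 1 + x := pos_of_mul_pos_left (by linarith : 0 < (1 + x) * p1) p00.le
  have y1 : 0 < 1 - y := pos_of_mul_pos_left (by linarith : 0 < (1 - y) * p2) p01.le
  have y2 : 0 < 1 + y := pos_of_mul_pos_left (by linarith : 0 < (1 + y) * p2) p01.le
  have k1 : E ^ 2 = (p1 * q2) * (p2 * q1) * ((1 - x ^ 2) * (1 - y ^ 2)) := by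
    rw [sq]; nth_rewrite 1 [hEE]; rw [hEE']; ring
  have pq : 0 < (p1 * q2) * (p2 * q1) := by positivity
  have l1 : (1 + x) * (1 + y) ≤ (1 - x) * (1 - y) := by
    rw [k1] at h1
    have h3 : ((p1 * q2) * (p2 * q1) * ((1 - x) * (1 - y))) * ((1 + x) * (1 + y)) ≤
      ((p1 * q2) * (p2 * q1) * ((1 - x) * (1 - y))) * ((1 - x) * (1 - y)) := by linarith
    exact le_of_mul_le_mul_left h3 (by positivity)
  have l2 : (1 - x) * (1 - y) ≤ (1 + x) * (1 + y) := by
    rw [k1] at h2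
    have h3 : ((p1 * q2) * (p2 * q1) * ((1 + x) * (1 + y))) * ((1 - x) * (1 - y)) ≤
      ((p1 * q2) * (p2 * q1) * ((1 + x) * (1 + y))) * ((1 + x) * (1 + y)) := by linarith
    exact le_of_mul_le_mul_left h3 (by positivity)
  have hxy : y = -x := by linarith
  subst hxy
  -- The two expressions of `E` are now `(1 - x²) * p2 * q1` and `(1 - x²) * p1 * q2`, with `1 - x²
  -- > 0`.
  have : (1 - x ^ 2) * (p1 * q2 - p2 * q1) = 0 := by linear_combination hEE - hEE'
  rw [dV, mul_one] at this
  nlinarith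

/-! ### Position of two lines in matrix form -/

/-- The hypothesis says that `V` sends no point of the right half-plane to the left one. At the
boundary, `V` maps nonnegative vectors to vectors whose coordinates do not have opposite signs,
hence the columns of `V` have a common sign. -/
lemma nonneg_of_side {V : SL(2, ℝ)}
    (h : ∀ X Y : ℝ, 0 < X → 0 < Y → 0 ≤ V 0 0 * V 1 0 * (X ^ 2 + Y ^ 2) + V 0 1 * V 1 1 +
      (V 0 0 * V 1 1 + V 0 1 * V 1 0) * X) :
    (∀ i j, 0 ≤ V i j) ∨ ∀ i j, 0 ≤ (-V) i j := by
  have d := sl_det V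
  have key : ∀ X W : ℝ, 0 ≤ X → 0 ≤ W →
      0 ≤ (V 0 0 * X + V 0 1 * W) * (V 1 0 * X + V 1 1 * W) := by
    intro X W hX hW
    -- Homogenized value of the hypothesis at the point `((X + ε) + iε) / (W + ε)`, which tends to
    -- the boundary point `X / W`.
    let f : ℝ → ℝ := fun ε => V 0 0 * V 1 0 * ((X + ε) ^ 2 + ε ^ 2) +
      V 0 1 * V 1 1 * (W + ε) ^ 2 + (V 0 0 * V 1 1 + V 0 1 * V 1 0) * (X + ε) * (W + ε)
    have hf : Continuous f := by fun_prop
    have h0 : f 0 = (V 0 0 * X + V 0 1 * W) * (V 1 0 * X + V 1 1 * W) := by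
      simp only [f]; ring
    rw [← h0]
    refine ge_of_tendsto ((hf.tendsto 0).mono_left (nhdsWithin_le_nhds (s := Set.Ioi 0))) ?_
    filter_upwards [self_mem_nhdsWithin] with ε hε
    have hε : 0 < ε := hε
    have hW' : 0 < W + ε := by linarith
    have := mul_nonneg (sq_nonneg (W + ε)) (h ((X + ε) / (W + ε)) (ε / (W + ε))
      (by positivity) (by positivity))
    refine this.trans_eq ?_
    simp only [f]
    field_simp
  have k1 := key 1 0 zero_le_one le_rfl
  have k2 := key 0 1 le_rfl zero_le_one
  simp only [mul_one, mul_zero, add_zero, zero_add] at k1 k2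
  simp only [Fin.forall_fin_two, sl_neg_apply]
  rcases mul_nonneg_iff.1 k1 with ⟨h1, h2⟩ | ⟨h1, h2⟩ <;>
  rcases mul_nonneg_iff.1 k2 with ⟨h3, h4⟩ | ⟨h3, h4⟩
  · exact Or.inl ⟨⟨h1, h3⟩, h2, h4⟩
  -- For columns of opposite signs, this nonnegative vector is sent to `(-1, 1)`, its coordinates
  -- being chosen so that those of the image add up to 0.
  · have := key (-V 0 1 - V 1 1) (V 0 0 + V 1 0) (by linarith) (by linarith)
    rw [show V 0 0 * (-V 0 1 - V 1 1) + V 0 1 * (V 0 0 + V 1 0) = -1 by linarith,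
      show V 1 0 * (-V 0 1 - V 1 1) + V 1 1 * (V 0 0 + V 1 0) = 1 by linarith] at this
    norm_num at this
  · have := key (V 0 1 + V 1 1) (-V 0 0 - V 1 0) (by linarith) (by linarith)
    rw [show V 0 0 * (V 0 1 + V 1 1) + V 0 1 * (-V 0 0 - V 1 0) = 1 by linarith,
      show V 1 0 * (V 0 1 + V 1 1) + V 1 1 * (-V 0 0 - V 1 0) = -1 by linarith] at this
    norm_num at this
  · exact Or.inr ⟨⟨by linarith, by linarith⟩, by linarith, by linarith⟩

/-- Up to half-turns and sign, a matrix with no sign obstruction is positive. -/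
lemma exists_halfTurn_pos {V : SL(2, ℝ)} (h : 0 < V 0 0 * V 1 0 * (V 0 1 * V 1 1)) :
    ∃ ε δ : SL(2, ℝ), (ε = 1 ∨ ε = halfTurn) ∧ (δ = 1 ∨ δ = halfTurn ∨ δ = -1 ∨ δ = -halfTurn) ∧
      ∀ i j, 0 < (ε * V * δ) i j := by
  have d := sl_det V
  obtain ⟨t1, t2, t3, t4⟩ := halfTurn_apply
  simp only [Fin.forall_fin_two]
  rcases pos_and_pos_or_neg_and_neg_of_mul_pos h with ⟨h1, h2⟩ | ⟨h1, h2⟩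
  · rcases pos_and_pos_or_neg_and_neg_of_mul_pos h1 with ⟨a, b⟩ | ⟨a, b⟩ <;>
    rcases pos_and_pos_or_neg_and_neg_of_mul_pos h2 with ⟨a', b'⟩ | ⟨a', b'⟩
    · exact ⟨1, 1, by simp, by simp, by simp [*]⟩
    · exact ⟨1, -halfTurn, by simp, by simp, by simp [sl_mul_apply, sl_neg_apply, *]⟩
    · exact ⟨1, halfTurn, by simp, by simp, by simp [sl_mul_apply, *]⟩
    · exact ⟨1, -1, by simp, by simp, by simp [sl_neg_apply, *]⟩
  · rcases mul_neg_iff.1 h1 with ⟨a, b⟩ | ⟨a, b⟩ <;>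
    rcases mul_neg_iff.1 h2 with ⟨a', b'⟩ | ⟨a', b'⟩
    · exact ⟨halfTurn, 1, by simp, by simp, by simp [sl_mul_apply, *]⟩
    · exact ⟨halfTurn, -halfTurn, by simp, by simp, by simp [sl_mul_apply, sl_neg_apply, *]⟩
    · exact ⟨halfTurn, halfTurn, by simp, by simp, by simp [sl_mul_apply, *]⟩
    · exact ⟨halfTurn, -1, by simp, by simp, by simp [sl_mul_apply, sl_neg_apply, *]⟩

/-! ### The action of `PSL₂(ℝ)` in coordinates -/

lemma mk_eq_mk_iff {A B : SL(2, ℝ)} : (A : G₀) = (B : G₀) ↔ A = B ∨ A = -B := by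
  rw [QuotientGroup.eq, Matrix.SpecialLinearGroup.mem_center_iff]
  constructor
  · rintro ⟨r, hr, h⟩
    have hB : ∀ i j, B i j = A i j * r := fun i j => by
      have h1 : B = A * (A⁻¹ * B) := by group
      have h2 : ∀ i j, (A⁻¹ * B) i j = Matrix.scalar (Fin 2) r i j := fun i j => by rw [h]
      rw [h1, sl_mul_apply, h2, h2]
      fin_cases j <;> simp
    rw [Fintype.card_fin, sq_eq_one_iff] at hr
    rcases hr with rfl | rfl
    · exact Or.inl (sl_ext (by simp [hB]) (by simp [hB]) (by simp [hB]) (by simp [hB]))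
    · exact Or.inr (sl_ext (by simp [hB, sl_neg_apply]) (by simp [hB, sl_neg_apply])
        (by simp [hB, sl_neg_apply]) (by simp [hB, sl_neg_apply]))
  · rintro (rfl | rfl)
    · exact ⟨1, by simp, by simp⟩
    · refine ⟨-1, by simp, ?_⟩
      have : (-B)⁻¹ * B = -1 := by
        rw [inv_mul_eq_iff_eq_mul]
        simp
      rw [this]
      ext i j
      fin_cases i <;> fin_cases j <;> simp

lemma mk_neg (A : SL(2, ℝ)) : ((-A : SL(2, ℝ)) : G₀) = A := mk_eq_mk_iff.2 (Or.inr rfl)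

lemma exists_mk (g : G₀) : ∃ A : SL(2, ℝ), (A : G₀) = g := QuotientGroup.mk_surjective g

lemma coe_mk_smul (A : SL(2, ℝ)) (z : ℍ) :
    (((A : G₀) • z : ℍ) : ℂ) = ((A 0 0 : ℂ) * z + A 0 1) / ((A 1 0 : ℂ) * z + A 1 1) := by
  rw [mk_smul, UpperHalfPlane.coe_specialLinearGroup_apply]
  rfl

lemma denom_ne_zero (A : SL(2, ℝ)) (z : ℍ) : (A 1 0 : ℂ) * z + A 1 1 ≠ 0 := by
  intro h
  have hi := congrArg Complex.im h
  have hr := congrArg Complex.re h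
  simp at hi hr
  have d := sl_det A
  rcases hi with h0 | h0
  · rw [h0] at hr d
    rw [zero_mul, zero_add] at hr
    rw [hr] at d
    norm_num at d
  · exact z.im_ne_zero h0

lemma re_mk_smul (A : SL(2, ℝ)) (z : ℍ) :
    ((A : G₀) • z).re * Complex.normSq ((A 1 0 : ℂ) * z + A 1 1) =
      A 0 0 * A 1 0 * (z.re ^ 2 + z.im ^ 2) + A 0 1 * A 1 1 +
        (A 0 0 * A 1 1 + A 0 1 * A 1 0) * z.re := by
  have h0 := denom_ne_zero A z
  have h1 : ((A : G₀) • z).re = (((A 0 0 : ℂ) * z + A 0 1) / ((A 1 0 : ℂ) * z + A 1 1)).re := by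
    rw [← coe_mk_smul]; rfl
  rw [h1, Complex.div_re, ← add_div, div_mul_cancel₀ _ (by simpa using h0)]
  simp
  ring

lemma normSq_denom_pos (A : SL(2, ℝ)) (z : ℍ) :
    0 < Complex.normSq ((A 1 0 : ℂ) * z + A 1 1) :=
  Complex.normSq_pos.2 (denom_ne_zero A z)

instance : IsIsometricSMul G₀ ℍ :=
  ⟨fun g => by
    obtain ⟨A, rfl⟩ := exists_mk g
    exact isometry_smul ℍ A⟩

/-! ### Geodesic lines -/

/-- The imaginary axis. -/
def imAxis : Set ℍ := {z | z.re = 0}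

/-- The half-plane to the left of the imaginary axis. -/
def leftHalf : Set ℍ := {z | z.re < 0}

/-- The half-plane to the right of the imaginary axis. -/
def rightHalf : Set ℍ := {z | 0 < z.re}

/-- The unit speed parametrization of the imaginary axis. -/
noncomputable def vert (t : ℝ) : ℍ := UpperHalfPlane.mk ⟨0, Real.exp t⟩ (Real.exp_pos t)

lemma vert_re (t : ℝ) : (vert t).re = 0 := rfl

lemma vert_im (t : ℝ) : (vert t).im = Real.exp t := rfl

lemma eq_vert_of_re_eq_zero {z : ℍ} (hz : z.re = 0) : z = vert (Real.log z.im) :=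
  UpperHalfPlane.ext_re_im hz (by rw [vert_im, Real.exp_log z.im_pos])

lemma isParametrization_vert : IsParametrization vert imAxis :=
  ⟨UpperHalfPlane.isometry_vertical_line 0, by
    ext z
    exact ⟨by rintro ⟨t, rfl⟩; rfl, fun hz => ⟨_, (eq_vert_of_re_eq_zero hz).symm⟩⟩⟩

lemma IsParametrization.smul {γ : ℝ → ℍ} {L : Set ℍ} (h : IsParametrization γ L) (g : G₀) :
    IsParametrization (fun t => g • γ t) (g • L) :=
  ⟨(isometry_smul ℍ g).comp h.1, by rw [← h.2]; exact Set.range_comp (fun z => g • z) γ⟩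

lemma mem_imAxis_iff {A : SL(2, ℝ)} {z : ℍ} : (A : G₀) • z ∈ imAxis ↔
    A 0 0 * A 1 0 * (z.re ^ 2 + z.im ^ 2) + A 0 1 * A 1 1 +
        (A 0 0 * A 1 1 + A 0 1 * A 1 0) * z.re = 0 := by
  rw [← re_mk_smul]
  simp [imAxis, (normSq_denom_pos A z).ne']

lemma mem_leftHalf_iff {A : SL(2, ℝ)} {z : ℍ} : (A : G₀) • z ∈ leftHalf ↔
    A 0 0 * A 1 0 * (z.re ^ 2 + z.im ^ 2) + A 0 1 * A 1 1 +
        (A 0 0 * A 1 1 + A 0 1 * A 1 0) * z.re < 0 := by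
  rw [← re_mk_smul]
  exact ⟨fun h => mul_neg_of_neg_of_pos h (normSq_denom_pos A z),
    fun h => neg_of_mul_neg_left h (normSq_denom_pos A z).le⟩

lemma mem_rightHalf_iff {A : SL(2, ℝ)} {z : ℍ} : (A : G₀) • z ∈ rightHalf ↔
    0 < A 0 0 * A 1 0 * (z.re ^ 2 + z.im ^ 2) + A 0 1 * A 1 1 +
        (A 0 0 * A 1 1 + A 0 1 * A 1 0) * z.re := by
  rw [← re_mk_smul]
  exact ⟨fun h => mul_pos h (normSq_denom_pos A z),
    fun h => pos_of_mul_pos_left h (normSq_denom_pos A z).le⟩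

lemma exists_rotation (w : ℍ) :
    ∃ A : SL(2, ℝ), (A : G₀) • UpperHalfPlane.I = UpperHalfPlane.I ∧ (A : G₀) • w ∈ imAxis := by
  obtain ⟨P, hP⟩ : ∃ P : ℝ, P = (1 - (w.re ^ 2 + w.im ^ 2)) / 2 := ⟨_, rfl⟩
  obtain ⟨θ, hθ⟩ : ∃ θ : ℝ, Real.sin (2 * θ) * P + Real.cos (2 * θ) * w.re = 0 := by
    -- This choice makes `(sin 2θ, cos 2θ)` orthogonal to `(P, w.re)`.
    refine ⟨Complex.arg ⟨P, -w.re⟩ / 2, ?_⟩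
    rw [mul_div_cancel₀ _ (two_ne_zero' ℝ)]
    have h1 := Complex.norm_mul_cos_arg ⟨P, -w.re⟩
    have h2 := Complex.norm_mul_sin_arg ⟨P, -w.re⟩
    by_cases h0 : (⟨P, -w.re⟩ : ℂ) = 0
    · have e1 : P = 0 := congrArg Complex.re h0
      have e2 : -w.re = 0 := congrArg Complex.im h0
      rw [e1, neg_eq_zero.1 e2]
      ring
    · have : ‖(⟨P, -w.re⟩ : ℂ)‖ ≠ 0 := norm_ne_zero_iff.2 h0
      apply mul_left_cancel₀ this
      simp only at h1 h2
      linear_combination P * h2 + w.re * h1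
  rw [Real.sin_two_mul, Real.cos_two_mul'] at hθ
  have hd : Real.cos θ * Real.cos θ - Real.sin θ * -Real.sin θ = 1 := by
    have := Real.sin_sq_add_cos_sq θ
    linarith
  obtain ⟨m1, m2, m3, m4⟩ := slMk_apply _ _ _ _ hd
  refine ⟨slMk _ _ _ _ hd, ?_, ?_⟩
  · have h0 := denom_ne_zero (slMk _ _ _ _ hd) UpperHalfPlane.I
    rw [← UpperHalfPlane.coe_inj, coe_mk_smul, div_eq_iff h0, m1, m2, m3, m4]
    simp only [UpperHalfPlane.coe_I, Complex.ofReal_neg]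
    linear_combination (Real.sin θ : ℂ) * Complex.I_mul_I
  · rw [mem_imAxis_iff, m1, m2, m3, m4]
    rw [hP] at hθ
    linear_combination hθ

lemma halfTurn_smul_vert (t : ℝ) : (halfTurn : G₀) • vert t = vert (-t) := by
  obtain ⟨h1, h2, h3, h4⟩ := halfTurn_apply
  rw [← UpperHalfPlane.coe_inj, coe_mk_smul, h1, h2, h3, h4]
  have e : ∀ s, (vert s : ℂ) = Real.exp s * Complex.I := fun s => by
    apply Complex.ext <;> simp [vert, -Complex.ofReal_exp]
  have : (Real.exp t : ℂ) ≠ 0 := by exact_mod_cast (Real.exp_pos t).ne'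
  rw [e, e, Real.exp_neg]
  push_cast at *
  have hI := Complex.I_ne_zero
  field_simp
  simp only [zero_mul, zero_add, add_zero]
  linear_combination (-Complex.exp t) * Complex.I_mul_I

lemma vert_zero : vert 0 = UpperHalfPlane.I := by
  apply UpperHalfPlane.ext_re_im
  · simp [vert_re]
  · simp [vert_im]

/-- Subtracting the two `cosh` distance formulas eliminates the quadratic terms in `w` and gives
`w.im = exp t`; either formula then gives `w.re = 0`. -/
lemma eq_vert_of_dist {w : ℍ} {t : ℝ} (h0 : dist (vert 0) w = |t|)
    (h1 : dist (vert 1) w = |t - 1|) : w = vert t := by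
  have c0 := UpperHalfPlane.cosh_dist' (vert 0) w
  have c1 := UpperHalfPlane.cosh_dist' (vert 1) w
  have hw := w.im_pos
  have e0 := Real.exp_pos t
  have e1 := Real.exp_pos 1
  have e2 : 1 < Real.exp 1 := Real.one_lt_exp_iff.2 one_pos
  rw [h0, Real.cosh_abs, vert_re, vert_im, Real.exp_zero, eq_div_iff (by positivity),
    Real.cosh_eq, Real.exp_neg] at c0
  rw [h1, Real.cosh_abs, vert_re, vert_im, eq_div_iff (by positivity), Real.cosh_eq, neg_sub,
    Real.exp_sub, Real.exp_sub] at c1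
  generalize Real.exp 1 = e at *
  obtain ⟨s, hs⟩ : ∃ s, s = Real.exp t := ⟨_, rfl⟩
  rw [← hs] at c0 c1 e0
  field_simp at c0 c1
  have him : w.im = s := by
    have h3 : (e ^ 2 - 1) * (w.im - s) = 0 := by
      have h4 : s * ((e ^ 2 - 1) * (w.im - s)) = 0 := by
        nlinarith
      exact (mul_eq_zero.1 h4).resolve_left e0.ne'
    have h5 : e ^ 2 - 1 ≠ 0 := by nlinarith
    linarith [(mul_eq_zero.1 h3).resolve_left h5]
  apply UpperHalfPlane.ext_re_im
  · rw [vert_re]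
    rw [him] at c0
    have h6 : s * w.re ^ 2 = 0 := by nlinarith
    exact pow_eq_zero_iff two_ne_zero |>.1 ((mul_eq_zero.1 h6).resolve_left e0.ne')
  · rw [him, vert_im, hs]

/-- Every unit speed geodesic is a translate of the imaginary axis. -/
lemma exists_smul_vert {γ : ℝ → ℍ} (hγ : Isometry γ) :
    ∃ x : SL(2, ℝ), ∀ t, γ t = (x : G₀) • vert t := by
  obtain ⟨y, hy⟩ : ∃ y : G₀, y • vert 0 = γ 0 :=
    ⟨((γ 0).toSL2R : SL(2, ℝ)), by rw [vert_zero, mk_smul, UpperHalfPlane.toSL2R_smul_I]⟩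
  obtain ⟨A, hA, hA'⟩ := exists_rotation (y⁻¹ • γ 1)
  rw [← vert_zero] at hA
  obtain ⟨g, hg0, hg1⟩ : ∃ g : G₀, g • γ 0 = vert 0 ∧ g • γ 1 = vert 1 := by
    have k0 : ((A : G₀) * y⁻¹) • γ 0 = vert 0 := by rw [← hy, mul_smul, inv_smul_smul, hA]
    have k1 := eq_vert_of_re_eq_zero (show (((A : G₀) * y⁻¹) • γ 1).re = 0 by
      rw [mul_smul]; exact hA')
    have hd : dist (((A : G₀) * y⁻¹) • γ 0) (((A : G₀) * y⁻¹) • γ 1) = 1 := by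
      rw [dist_smul, hγ.dist_eq]
      simp
    rw [k0, k1, isParametrization_vert.1.dist_eq, Real.dist_eq, zero_sub, abs_neg] at hd
    rcases eq_or_eq_neg_of_abs_eq hd with h | h
    · exact ⟨_, k0, by rw [k1, h]⟩
    -- The geodesic runs down the axis; the half-turn about `i` reverses it.
    · refine ⟨(halfTurn : G₀) * (A * y⁻¹), ?_, ?_⟩
      · rw [mul_smul, k0, halfTurn_smul_vert, neg_zero]
      · rw [mul_smul, k1, h, halfTurn_smul_vert, neg_neg]
  obtain ⟨x, hx⟩ := exists_mk g⁻¹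
  refine ⟨x, fun t => ?_⟩
  rw [hx, eq_inv_smul_iff]
  apply eq_vert_of_dist
  · rw [← hg0, dist_smul, hγ.dist_eq, Real.dist_eq, zero_sub, abs_neg]
  · rw [← hg1, dist_smul, hγ.dist_eq, Real.dist_eq, abs_sub_comm]

lemma IsParametrization.exists_smul_vert {γ : ℝ → ℍ} {L : Set ℍ} (h : IsParametrization γ L) :
    ∃ x : SL(2, ℝ), (∀ t, γ t = (x : G₀) • vert t) ∧ L = (x : G₀) • imAxis := by
  obtain ⟨x, hx⟩ := AdSCrooked.exists_smul_vert h.1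
  refine ⟨x, hx, ?_⟩
  rw [← h.2, ← (isParametrization_vert.smul x).2]
  exact congrArg Set.range (funext hx)

lemma IsGeodesicLine.exists_eq_smul {L : Set ℍ} (h : IsGeodesicLine L) :
    ∃ x : SL(2, ℝ), L = (x : G₀) • imAxis := by
  obtain ⟨γ, hγ⟩ := h
  obtain ⟨x, -, hx⟩ := hγ.exists_smul_vert
  exact ⟨x, hx⟩

lemma halfTurn_smul_imAxis : (halfTurn : G₀) • imAxis = imAxis := by
  rw [← (isParametrization_vert.smul halfTurn).2]
  simp_rw [halfTurn_smul_vert]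
  rw [← isParametrization_vert.2]
  exact (neg_surjective (G := ℝ)).range_comp vert

/-! ### Sides of a line -/

lemma halfTurn_smul_leftHalf : (halfTurn : G₀) • leftHalf = rightHalf := by
  obtain ⟨h1, h2, h3, h4⟩ := halfTurn_apply
  obtain ⟨i1, i2, i3, i4⟩ := sl_inv_apply halfTurn
  ext z
  rw [Set.mem_smul_set_iff_inv_smul_mem, ← QuotientGroup.mk_inv, mem_leftHalf_iff, i1, i2, i3, i4,
    h1, h2, h3, h4]
  simp [rightHalf]

lemma halfTurn_smul_rightHalf : (halfTurn : G₀) • rightHalf = leftHalf := by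
  obtain ⟨h1, h2, h3, h4⟩ := halfTurn_apply
  obtain ⟨i1, i2, i3, i4⟩ := sl_inv_apply halfTurn
  ext z
  rw [Set.mem_smul_set_iff_inv_smul_mem, ← QuotientGroup.mk_inv, mem_rightHalf_iff, i1, i2, i3, i4,
    h1, h2, h3, h4]
  simp [leftHalf]

lemma isPreconnected_of_convex {s : Set ℍ} {t : Set ℂ} (ht : Convex ℝ t)
    (h : (UpperHalfPlane.coe '' s) = t) : IsPreconnected s :=
  (UpperHalfPlane.isEmbedding_coe.isInducing.isPreconnected_image).1
    (h ▸ ht.isPreconnected)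

lemma isPreconnected_leftHalf : IsPreconnected leftHalf := by
  refine isPreconnected_of_convex (t := {z | z.re < 0} ∩ {z | 0 < z.im})
    ((convex_halfSpace_re_lt 0).inter (convex_halfSpace_im_gt 0)) ?_
  ext z
  exact ⟨by rintro ⟨w, hw, rfl⟩; exact ⟨hw, w.im_pos⟩, fun h => ⟨⟨z, h.2⟩, h.1, rfl⟩⟩

lemma isPreconnected_rightHalf : IsPreconnected rightHalf := by
  refine isPreconnected_of_convex (t := {z | 0 < z.re} ∩ {z | 0 < z.im})
    ((convex_halfSpace_re_gt 0).inter (convex_halfSpace_im_gt 0)) ?_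
  ext z
  exact ⟨by rintro ⟨w, hw, rfl⟩; exact ⟨hw, w.im_pos⟩, fun h => ⟨⟨z, h.2⟩, h.1, rfl⟩⟩

lemma compl_imAxis : imAxisᶜ = leftHalf ∪ rightHalf := by
  ext z
  exact ne_iff_lt_or_gt

lemma isOpen_leftHalf : IsOpen leftHalf := isOpen_lt UpperHalfPlane.continuous_re continuous_const

lemma isOpen_rightHalf : IsOpen rightHalf :=
  isOpen_lt continuous_const UpperHalfPlane.continuous_re

lemma disjoint_leftHalf_rightHalf : Disjoint leftHalf rightHalf :=
  Set.disjoint_left.2 fun z (h : z.re < 0) (h' : 0 < z.re) => lt_asymm h h'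

lemma connectedComponentIn_eq_of_union {s u v : Set ℍ} (hs : s = u ∪ v) (hu : IsOpen u)
    (hv : IsOpen v) (huv : Disjoint u v) (hc : IsPreconnected u) {z : ℍ} (hz : z ∈ u) :
    connectedComponentIn s z = u := by
  apply subset_antisymm
  · refine isPreconnected_connectedComponentIn.subset_left_of_subset_union hu hv huv
      (hs ▸ connectedComponentIn_subset s z) ⟨z, mem_connectedComponentIn (hs ▸ Or.inl hz), hz⟩
  · exact hc.subset_connectedComponentIn hz (hs ▸ Set.subset_union_left)

lemma isSide_imAxis_iff {P : Set ℍ} : IsSide imAxis P ↔ P = leftHalf ∨ P = rightHalf := by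
  have hl : ∀ z ∈ leftHalf, connectedComponentIn imAxisᶜ z = leftHalf := fun z hz =>
    connectedComponentIn_eq_of_union compl_imAxis isOpen_leftHalf isOpen_rightHalf
      disjoint_leftHalf_rightHalf isPreconnected_leftHalf hz
  have hr : ∀ z ∈ rightHalf, connectedComponentIn imAxisᶜ z = rightHalf := fun z hz =>
    connectedComponentIn_eq_of_union (compl_imAxis.trans (Set.union_comm _ _)) isOpen_rightHalf
      isOpen_leftHalf disjoint_leftHalf_rightHalf.symm isPreconnected_rightHalf hz
  constructor
  · rintro ⟨z, hz, rfl⟩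
    rw [compl_imAxis] at hz
    exact hz.imp (hl z) (hr z)
  · rintro (rfl | rfl)
    · have hz : (⟨⟨-1, 1⟩, one_pos⟩ : ℍ) ∈ leftHalf := by
        change (-1 : ℝ) < 0
        norm_num
      exact ⟨_, by rw [compl_imAxis]; exact Or.inl hz, (hl _ hz).symm⟩
    · have hz : (⟨⟨1, 1⟩, one_pos⟩ : ℍ) ∈ rightHalf := by
        change (0 : ℝ) < 1
        norm_num
      exact ⟨_, by rw [compl_imAxis]; exact Or.inr hz, (hr _ hz).symm⟩

lemma IsSide.smul {L P : Set ℍ} (h : IsSide L P) (g : G₀) : IsSide (g • L) (g • P) := by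
  obtain ⟨z, hz, rfl⟩ := h
  refine ⟨g • z, ?_, ?_⟩
  · rw [← Set.smul_set_compl]
    exact Set.smul_mem_smul_set hz
  · rw [← Set.smul_set_compl]
    exact (Homeomorph.image_connectedComponentIn (Homeomorph.smul g) hz)

lemma isSide_smul_imAxis_iff {x : G₀} {P : Set ℍ} :
    IsSide (x • imAxis) P ↔ P = x • leftHalf ∨ P = x • rightHalf := by
  rw [← inv_smul_eq_iff, ← inv_smul_eq_iff, ← isSide_imAxis_iff]
  exact ⟨fun h => by simpa using h.smul x⁻¹, fun h => by simpa using h.smul x⟩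

/-! ### Continuity of the action on the Riemann sphere -/

lemma tendsto_coe_infty_of_norm {α : Type*} {l : Filter α} {f : α → ℂ}
    (h : Filter.Tendsto (fun x => ‖f x‖) l Filter.atTop) :
    Filter.Tendsto (fun x => (f x : OnePoint ℂ)) l (𝓝 OnePoint.infty) := by
  refine OnePoint.tendsto_coe_infty.comp ?_
  rw [Filter.coclosedCompact_eq_cocompact, ← Metric.cobounded_eq_cocompact]
  exact tendsto_norm_atTop_iff_cobounded.1 h

/-- Endpoints and attracting fixed points are defined by closures and limits in the Riemann sphere;
this continuity lets them be transported by the group. -/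
lemma continuous_gl_smul (g : GL (Fin 2) ℂ) :
    Continuous (fun p : OnePoint ℂ => g • p) := by
  have hdet : g 0 0 * g 1 1 - g 0 1 * g 1 0 ≠ 0 := by
    rw [← Matrix.det_fin_two]
    exact g.det_ne_zero
  rw [OnePoint.continuous_iff, Filter.coclosedCompact_eq_cocompact,
    ← Metric.cobounded_eq_cocompact]
  simp only [OnePoint.smul_some_eq_ite, OnePoint.smul_infty_eq_ite]
  generalize g 0 0 = a, g 0 1 = b, g 1 0 = c, g 1 1 = d at *
  constructor
  · by_cases hc : c = 0
    · subst hc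
      have hd : d ≠ 0 := fun h => hdet (by rw [h]; ring)
      have ha : a ≠ 0 := fun h => hdet (by rw [h]; ring)
      simp only [zero_mul, zero_add, hd, if_false, if_true]
      apply tendsto_coe_infty_of_norm
      have h1 : Filter.Tendsto (fun z : ℂ => ‖a / d‖ * ‖z‖ - ‖b / d‖) (Bornology.cobounded ℂ)
          Filter.atTop :=
        Filter.tendsto_atTop_add_const_right _ _
          (tendsto_norm_cobounded_atTop.const_mul_atTop (norm_pos_iff.2 (div_ne_zero ha hd)))
      refine Filter.tendsto_atTop_mono (fun z => ?_) h1
      rw [← norm_mul, add_div, mul_div_right_comm]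
      exact norm_sub_le_norm_add _ _
    · simp only [hc, if_false]
      have hlim : Filter.Tendsto (fun z : ℂ => c * z + d) (Bornology.cobounded ℂ)
          (Bornology.cobounded ℂ) := by
        rw [← tendsto_norm_atTop_iff_cobounded]
        have h1 : Filter.Tendsto (fun z : ℂ => ‖c‖ * ‖z‖ - ‖d‖) (Bornology.cobounded ℂ)
            Filter.atTop :=
          Filter.tendsto_atTop_add_const_right _ _
            (tendsto_norm_cobounded_atTop.const_mul_atTop (norm_pos_iff.2 hc))
        refine Filter.tendsto_atTop_mono (fun z => ?_) h1
        rw [← norm_mul]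
        exact norm_sub_le_norm_add _ _
      have h2 : Filter.Tendsto (fun z : ℂ => a / c - (a * d - b * c) / c * (c * z + d)⁻¹)
          (Bornology.cobounded ℂ) (𝓝 (a / c - (a * d - b * c) / c * 0)) :=
        tendsto_const_nhds.sub
          (tendsto_const_nhds.mul (Filter.tendsto_inv₀_cobounded.comp hlim))
      rw [mul_zero, sub_zero] at h2
      refine ((OnePoint.continuous_coe.tendsto _).comp h2).congr' ?_
      have h3 : ∀ᶠ z in Bornology.cobounded ℂ, c * z + d ≠ 0 :=
        hlim.eventually (Bornology.eventually_ne_cobounded 0)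
      filter_upwards [h3] with z hz
      simp only [hz, if_false, Function.comp_apply]
      congr 1
      field_simp
      ring
  · rw [continuous_iff_continuousAt]
    intro z
    by_cases hz : c * z + d = 0
    · have hc : c ≠ 0 := by
        rintro rfl
        rw [zero_mul, zero_add] at hz
        exact hdet (by rw [hz]; ring)
      have hnum : a * z + b ≠ 0 := by
        intro h
        exact hdet (mul_left_cancel₀ hc (by linear_combination (a * c) * hz - c ^ 2 * h))
      -- At the pole, the formula holds only on a punctured neighbourhood, so the pole itself is
      -- treated separately.
      rw [ContinuousAt, if_pos hz, ← nhdsNE_sup_pure, Filter.tendsto_sup]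
      constructor
      · have hne : ∀ᶠ w in 𝓝[≠] z, c * w + d ≠ 0 := by
          filter_upwards [self_mem_nhdsWithin] with w hw h
          exact hw (mul_left_cancel₀ hc (by linear_combination h - hz))
        have h1 : Filter.Tendsto (fun w => ((a * w + b) / (c * w + d) : ℂ)) (𝓝[≠] z)
            (Bornology.cobounded ℂ) := by
          rw [← tendsto_norm_atTop_iff_cobounded]
          simp_rw [norm_div, div_eq_mul_inv]
          have t1 : Filter.Tendsto (fun w => ‖a * w + b‖) (𝓝[≠] z) (𝓝 ‖a * z + b‖) :=
            (Continuous.tendsto (by fun_prop) z).mono_left nhdsWithin_le_nhds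
          have t2 : Filter.Tendsto (fun w => ‖c * w + d‖) (𝓝[≠] z) (𝓝[>] 0) := by
            rw [tendsto_nhdsWithin_iff]
            constructor
            · have : Filter.Tendsto (fun w => ‖c * w + d‖) (𝓝 z) (𝓝 ‖c * z + d‖) :=
                Continuous.tendsto (by fun_prop) z
              rw [hz, norm_zero] at this
              exact this.mono_left nhdsWithin_le_nhds
            · filter_upwards [hne] with w hw
              exact norm_pos_iff.2 hw
          exact t1.pos_mul_atTop (norm_pos_iff.2 hnum) (tendsto_inv_nhdsGT_zero.comp t2)
        refine (tendsto_coe_infty_of_norm (tendsto_norm_atTop_iff_cobounded.2 h1)).congr' ?_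
        filter_upwards [hne] with w hw
        rw [if_neg hw]
      · rw [Filter.tendsto_pure_left]
        intro s hs
        rw [if_pos hz]
        exact mem_of_mem_nhds hs
    · have hne : ∀ᶠ w in 𝓝 z, c * w + d ≠ 0 :=
        ContinuousAt.eventually_ne (Continuous.continuousAt (by fun_prop)) hz
      have h1 : ContinuousAt (fun w => (((a * w + b) / (c * w + d) : ℂ) : OnePoint ℂ)) z :=
        OnePoint.continuous_coe.continuousAt.comp
          (ContinuousAt.div (by fun_prop) (by fun_prop) hz)
      refine h1.congr ?_
      filter_upwards [hne] with w hw
      rw [if_neg hw]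

/-- The action of an element of `SL₂(ℝ)` on the Riemann sphere. -/
noncomputable def sphereMap (A : SL(2, ℝ)) (p : OnePoint ℂ) : OnePoint ℂ :=
  (Matrix.GeneralLinearGroup.map Complex.ofRealHom (A : GL (Fin 2) ℝ)) • p

lemma continuous_sphereMap (A : SL(2, ℝ)) : Continuous (sphereMap A) := continuous_gl_smul _

lemma sphereMap_toSphere (A : SL(2, ℝ)) (z : ℍ) :
    sphereMap A (toSphere z) = toSphere ((A : G₀) • z) := by
  rw [sphereMap, toSphere, OnePoint.smul_some_eq_ite, toSphere, coe_mk_smul]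
  exact if_neg (denom_ne_zero A z)

lemma sphereMap_idealToSphere (A : SL(2, ℝ)) (ξ : OnePoint ℝ) :
    sphereMap A (idealToSphere ξ) = idealToSphere ((A : G₀) • ξ) := by
  rw [mk_smul_onePoint]
  exact (OnePoint.map_smul Complex.ofRealHom _ ξ).symm

/-! ### Equivariance -/

lemma IsEndpoint.smul {L : Set ℍ} {ξ : OnePoint ℝ} (h : IsEndpoint L ξ) (g : G₀) :
    IsEndpoint (g • L) (g • ξ) := by
  obtain ⟨A, rfl⟩ := exists_mk g
  rw [IsEndpoint, ← sphereMap_idealToSphere]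
  refine closure_mono ?_ (image_closure_subset_closure_image (continuous_sphereMap A)
    (Set.mem_image_of_mem _ h))
  rintro _ ⟨_, ⟨z, hz, rfl⟩, rfl⟩
  rw [sphereMap_toSphere]
  exact ⟨_, Set.smul_mem_smul_set hz, rfl⟩

lemma IsAttractingFixedPoint.conj {h : G₀} {ξ : OnePoint ℝ} (H : IsAttractingFixedPoint h ξ)
    (g : G₀) : IsAttractingFixedPoint (g * h * g⁻¹) (g • ξ) := by
  obtain ⟨A, rfl⟩ := exists_mk g
  refine ⟨by rw [mul_smul, inv_smul_smul, mul_smul, H.1], fun z => ?_⟩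
  have := ((continuous_sphereMap A).tendsto _).comp (H.2 ((A : G₀)⁻¹ • z))
  rw [sphereMap_idealToSphere] at this
  refine this.congr fun n => ?_
  rw [Function.comp_apply, sphereMap_toSphere, conj_pow, mul_smul, mul_smul]

/-! ### Classification by the trace and invariance under conjugation -/

lemma sl_conj_trace (x A : SL(2, ℝ)) :
    (x * A * x⁻¹) 0 0 + (x * A * x⁻¹) 1 1 = A 0 0 + A 1 1 := by
  obtain ⟨i1, i2, i3, i4⟩ := sl_inv_apply x
  simp only [sl_mul_apply, i1, i2, i3, i4]
  linear_combination (A 0 0 + A 1 1) * sl_det x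

lemma sl_discr (A : SL(2, ℝ)) :
    (A : Matrix (Fin 2) (Fin 2) ℝ).discr = (A 0 0 + A 1 1) ^ 2 - 4 := by
  rw [Matrix.discr_fin_two, A.2, Matrix.trace_fin_two]
  ring

lemma isElliptic_mk_iff {A : SL(2, ℝ)} : IsElliptic (A : G₀) ↔ (A 0 0 + A 1 1) ^ 2 < 4 := by
  constructor
  · rintro ⟨B, hB, h⟩
    rw [Matrix.IsElliptic, sl_discr] at h
    rcases mk_eq_mk_iff.1 hB with rfl | rfl
    · linarith
    · rw [sl_neg_apply, sl_neg_apply] at h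
      linarith
  · intro h
    exact ⟨A, rfl, by rw [Matrix.IsElliptic, sl_discr]; linarith⟩

lemma isHyperbolic_mk_iff {A : SL(2, ℝ)} : IsHyperbolic (A : G₀) ↔ 4 < (A 0 0 + A 1 1) ^ 2 := by
  constructor
  · rintro ⟨B, hB, h⟩
    rw [Matrix.IsHyperbolic, sl_discr] at h
    rcases mk_eq_mk_iff.1 hB with rfl | rfl
    · linarith
    · rw [sl_neg_apply, sl_neg_apply] at h
      linarith
  · intro h
    exact ⟨A, rfl, by rw [Matrix.IsHyperbolic, sl_discr]; linarith⟩

lemma mem_range_scalar_iff {A : SL(2, ℝ)} :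
    (A : Matrix (Fin 2) (Fin 2) ℝ) ∈ Set.range (Matrix.scalar (Fin 2)) ↔ (A : G₀) = 1 := by
  rw [show (1 : G₀) = ((1 : SL(2, ℝ)) : G₀) from rfl, mk_eq_mk_iff]
  constructor
  · rintro ⟨r, hr⟩
    have hA : ∀ i j, A i j = Matrix.scalar (Fin 2) r i j := fun i j => by rw [hr]
    have d := sl_det A
    simp only [hA, Matrix.scalar_apply] at d
    have hr1 : r = 1 ∨ r = -1 := by
      rw [← sq_eq_one_iff]
      simpa [sq] using d
    rcases hr1 with rfl | rfl
    · exact Or.inl (sl_ext (by simp [hA]) (by simp [hA]) (by simp [hA]) (by simp [hA]))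
    · exact Or.inr (sl_ext (by simp [hA, sl_neg_apply]) (by simp [hA, sl_neg_apply])
        (by simp [hA, sl_neg_apply]) (by simp [hA, sl_neg_apply]))
  · rintro (rfl | rfl)
    · exact ⟨1, by simp⟩
    · refine ⟨-1, ?_⟩
      ext i j
      fin_cases i <;> fin_cases j <;> simp

lemma isParabolic_mk_iff {A : SL(2, ℝ)} :
    IsParabolic (A : G₀) ↔ (A : G₀) ≠ 1 ∧ (A 0 0 + A 1 1) ^ 2 = 4 := by
  constructor
  · rintro ⟨B, hB, h⟩
    rw [Matrix.IsParabolic, sl_discr, mem_range_scalar_iff, hB] at h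
    refine ⟨h.1, ?_⟩
    rcases mk_eq_mk_iff.1 hB with rfl | rfl
    · linarith [h.2]
    · have := h.2
      rw [sl_neg_apply, sl_neg_apply] at this
      linarith
  · rintro ⟨h1, h2⟩
    exact ⟨A, rfl, by rwa [mem_range_scalar_iff], by rw [sl_discr]; linarith⟩

lemma IsElliptic.conj {h : G₀} (H : IsElliptic h) (g : G₀) : IsElliptic (g * h * g⁻¹) := by
  obtain ⟨x, rfl⟩ := exists_mk g
  obtain ⟨A, rfl⟩ := exists_mk h
  change IsElliptic ((x * A * x⁻¹ : SL(2, ℝ)) : G₀)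
  rw [isElliptic_mk_iff] at *
  rwa [sl_conj_trace]

lemma IsHyperbolic.conj {h : G₀} (H : IsHyperbolic h) (g : G₀) : IsHyperbolic (g * h * g⁻¹) := by
  obtain ⟨x, rfl⟩ := exists_mk g
  obtain ⟨A, rfl⟩ := exists_mk h
  change IsHyperbolic ((x * A * x⁻¹ : SL(2, ℝ)) : G₀)
  rw [isHyperbolic_mk_iff] at *
  rwa [sl_conj_trace]

lemma IsParabolic.conj {h : G₀} (H : IsParabolic h) (g : G₀) : IsParabolic (g * h * g⁻¹) := by
  obtain ⟨x, rfl⟩ := exists_mk g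
  obtain ⟨A, rfl⟩ := exists_mk h
  change IsParabolic ((x * A * x⁻¹ : SL(2, ℝ)) : G₀)
  rw [isParabolic_mk_iff] at *
  rw [sl_conj_trace]
  refine ⟨?_, H.2⟩
  change (x : G₀) * A * (x : G₀)⁻¹ ≠ 1
  rw [Ne, conj_eq_one_iff]
  exact H.1

lemma conj_mem_wing {h : G₀} {ξ : OnePoint ℝ} (H : h ∈ wing ξ) (g : G₀) :
    g * h * g⁻¹ ∈ wing (g • ξ) :=
  ⟨H.1.conj g, H.2.conj g⟩

lemma conj_mem_leftCrookedPlane {L : Set ℍ} {h : G₀} (H : h ∈ leftCrookedPlane L) (g : G₀) :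
    g * h * g⁻¹ ∈ leftCrookedPlane (g • L) := by
  rcases H with ((⟨h1, p, hp, h2⟩ | h1) | ⟨h1, ξ, hξ, h2⟩) | ⟨ξ, hξ, h1⟩
  · refine Or.inl (Or.inl (Or.inl ⟨h1.conj g, g • p, Set.smul_mem_smul_set hp, ?_⟩))
    rw [mul_smul, inv_smul_smul, mul_smul, h2]
  · refine Or.inl (Or.inl (Or.inr ?_))
    rw [Set.mem_singleton_iff] at *
    rw [h1]
    group
  · refine Or.inl (Or.inr ⟨h1.conj g, g • ξ, hξ.smul g, ?_⟩)
    rw [mul_smul, inv_smul_smul, mul_smul, h2]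
  · exact Or.inr ⟨g • ξ, hξ.smul g, conj_mem_wing h1 g⟩

lemma mem_leftCrookedPlane_smul_iff {L : Set ℍ} {g h : G₀} :
    h ∈ leftCrookedPlane (g • L) ↔ g⁻¹ * h * g ∈ leftCrookedPlane L := by
  constructor
  · intro H
    simpa using conj_mem_leftCrookedPlane H g⁻¹
  · intro H
    simpa [mul_assoc] using conj_mem_leftCrookedPlane H g

/-! ### The crooked plane of the imaginary axis -/

lemma halfTurn_smul_infty :
    (halfTurn : G₀) • (OnePoint.infty : OnePoint ℝ) = ((0 : ℝ) : OnePoint ℝ) := by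
  obtain ⟨h1, h2, h3, h4⟩ := halfTurn_apply
  rw [mk_smul_onePoint, OnePoint.smul_infty_eq_ite]
  change (if halfTurn 1 0 = 0 then _ else ((halfTurn 0 0 / halfTurn 1 0 : ℝ) : OnePoint ℝ)) = _
  rw [h1, h3]
  simp

lemma mk_smul_infty_iff {A : SL(2, ℝ)} :
    (A : G₀) • (OnePoint.infty : OnePoint ℝ) = OnePoint.infty ↔ A 1 0 = 0 := by
  rw [mk_smul_onePoint, OnePoint.smul_infty_eq_self_iff]
  rfl

lemma coe_vert (t : ℝ) : (vert t : ℂ) = (Real.exp t : ℂ) * Complex.I := by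
  apply Complex.ext <;> simp [vert, -Complex.ofReal_exp]

lemma isEndpoint_imAxis_infty : IsEndpoint imAxis OnePoint.infty := by
  have h : Filter.Tendsto (fun t : ℝ => toSphere (vert t)) Filter.atTop (𝓝 OnePoint.infty) := by
    apply tendsto_coe_infty_of_norm
    refine Real.tendsto_exp_atTop.congr fun t => ?_
    rw [coe_vert, norm_mul, Complex.norm_I, mul_one, Complex.norm_real, Real.norm_eq_abs,
      abs_of_pos (Real.exp_pos t)]
  exact mem_closure_of_tendsto h (Filter.Eventually.of_forall fun t => ⟨vert t, vert_re t, rfl⟩)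

lemma isEndpoint_imAxis_zero : IsEndpoint imAxis ((0 : ℝ) : OnePoint ℝ) := by
  rw [← halfTurn_smul_infty, ← halfTurn_smul_imAxis]
  exact isEndpoint_imAxis_infty.smul halfTurn

lemma isEndpoint_imAxis_iff {ξ : OnePoint ℝ} :
    IsEndpoint imAxis ξ ↔ ξ = OnePoint.infty ∨ ξ = ((0 : ℝ) : OnePoint ℝ) := by
  constructor
  · intro h
    cases ξ with
    | infty => exact Or.inl rfl
    | coe x =>
      refine Or.inr ?_
      have h1 : (x : ℂ) ∈ closure (UpperHalfPlane.coe '' imAxis) := by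
        rw [OnePoint.isOpenEmbedding_coe.isInducing.closure_eq_preimage_closure_image,
          Set.mem_preimage, Set.image_image]
        exact h
      have h2 : closure (UpperHalfPlane.coe '' imAxis) ⊆ {z : ℂ | z.re = 0} := by
        refine closure_minimal ?_ (isClosed_eq Complex.continuous_re continuous_const)
        rintro _ ⟨z, hz, rfl⟩
        exact hz
      have h3 : (x : ℂ).re = 0 := h2 h1
      rw [Complex.ofReal_re] at h3
      rw [h3]
  · rintro (rfl | rfl)
    · exact isEndpoint_imAxis_infty
    · exact isEndpoint_imAxis_zero

/-- An upper triangular matrix acts by `z ↦ a²z + ab`, which is scaling by `a²` about its fixed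
point `p`. -/
lemma coe_pow_smul {A : SL(2, ℝ)} (hA : A 1 0 = 0) {p : ℂ}
    (hp : p = (A 0 0 : ℂ) ^ 2 * p + A 0 0 * A 0 1) (z : ℍ) (n : ℕ) :
    (((A : G₀) ^ n • z : ℍ) : ℂ) = p + ((A 0 0 : ℂ) ^ 2) ^ n * (z - p) := by
  have d := sl_det A
  rw [hA, mul_zero, sub_zero] at d
  have d' : (A 0 0 : ℂ) * A 1 1 = 1 := by exact_mod_cast d
  have hd : (A 1 1 : ℂ) ≠ 0 := fun h => by simp [h] at d'
  induction n with
  | zero => simp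
  | succ n ih =>
    rw [pow_succ' (A : G₀), mul_smul, coe_mk_smul, ih, hA, Complex.ofReal_zero, zero_mul, zero_add,
      div_eq_iff hd]
    have h2 : p * A 1 1 = A 0 0 * p + A 0 1 := by
      nth_rewrite 1 [hp]
      linear_combination (A 0 0 * p + A 0 1) * d'
    linear_combination -h2 - (A 0 0 : ℂ) ^ (2 * n + 1) * (z - p) * d'

/-- By `coe_pow_smul`, orbits escape to infinity when the scaling factor exceeds 1, and converge to
a finite point when it is less than 1; factor 1 is not hyperbolic. -/
lemma mem_wing_infty_iff {A : SL(2, ℝ)} :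
    (A : G₀) ∈ wing OnePoint.infty ↔ A 1 0 = 0 ∧ A 1 1 ^ 2 < A 0 0 ^ 2 := by
  have d := sl_det A
  constructor
  · rintro ⟨hh, hfix, hlim⟩
    have hA := mk_smul_infty_iff.1 hfix
    refine ⟨hA, ?_⟩
    rw [isHyperbolic_mk_iff] at hh
    rw [hA, mul_zero, sub_zero] at d
    by_contra hle
    have ha : A 0 0 ^ 2 < 1 := by
      have h1 := (sq_le_one_of_mul_eq_one (mul_comm (A 0 0) _ ▸ d) (not_lt.1 hle)).1
      refine lt_of_le_of_ne h1 fun h2 => ?_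
      have h3 : A 1 1 ^ 2 = 1 := by
        have : A 0 0 ^ 2 * A 1 1 ^ 2 = 1 := by rw [← mul_pow, d, one_pow]
        rwa [h2, one_mul] at this
      nlinarith
    have hne : (1 : ℂ) - (A 0 0 : ℂ) ^ 2 ≠ 0 := by
      have : (1 : ℝ) - A 0 0 ^ 2 ≠ 0 := by linarith
      exact_mod_cast this
    have hp : (A 0 0 * A 0 1 / (1 - (A 0 0 : ℂ) ^ 2) : ℂ) =
        (A 0 0 : ℂ) ^ 2 * (A 0 0 * A 0 1 / (1 - (A 0 0 : ℂ) ^ 2)) + A 0 0 * A 0 1 := by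
      field_simp
      ring
    generalize (A 0 0 * A 0 1 / (1 - (A 0 0 : ℂ) ^ 2) : ℂ) = p at hp
    have h0 : Filter.Tendsto (fun n : ℕ => ((A 0 0 : ℂ) ^ 2) ^ n) Filter.atTop (𝓝 0) := by
      apply tendsto_pow_atTop_nhds_zero_of_norm_lt_one
      rw [norm_pow, Complex.norm_real, Real.norm_eq_abs, sq_abs]
      exact ha
    have h1 := (h0.mul_const ((UpperHalfPlane.I : ℂ) - p)).const_add p
    rw [zero_mul, add_zero] at h1
    have h2 := (OnePoint.continuous_coe.tendsto _).comp h1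
    have h3 := hlim UpperHalfPlane.I
    refine OnePoint.coe_ne_infty p (tendsto_nhds_unique h2 (h3.congr fun n => ?_))
    rw [toSphere, coe_pow_smul hA hp]
    rfl
  · rintro ⟨hA, hlt⟩
    rw [hA, mul_zero, sub_zero] at d
    have ha : 1 < A 0 0 ^ 2 := by
      have : A 0 0 ^ 2 * A 1 1 ^ 2 = 1 := by rw [← mul_pow, d, one_pow]
      nlinarith [sq_nonneg (A 1 1)]
    refine ⟨isHyperbolic_mk_iff.2 ?_, mk_smul_infty_iff.2 hA, fun z => ?_⟩
    · have h1 : 0 < (A 0 0 - A 1 1) ^ 2 := by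
        refine sq_pos_of_ne_zero (sub_ne_zero.2 fun h => ?_)
        rw [h] at hlt
        exact lt_irrefl _ hlt
      nlinarith
    have hne : (1 : ℂ) - (A 0 0 : ℂ) ^ 2 ≠ 0 := by
      have : (1 : ℝ) - A 0 0 ^ 2 ≠ 0 := by linarith
      exact_mod_cast this
    have hp : (A 0 0 * A 0 1 / (1 - (A 0 0 : ℂ) ^ 2) : ℂ) =
        (A 0 0 : ℂ) ^ 2 * (A 0 0 * A 0 1 / (1 - (A 0 0 : ℂ) ^ 2)) + A 0 0 * A 0 1 := by
      field_simp
      ring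
    have hpre : ∃ r : ℝ, (A 0 0 * A 0 1 / (1 - (A 0 0 : ℂ) ^ 2) : ℂ) = r :=
      ⟨A 0 0 * A 0 1 / (1 - (A 0 0) ^ 2), by push_cast; rfl⟩
    generalize (A 0 0 * A 0 1 / (1 - (A 0 0 : ℂ) ^ 2) : ℂ) = p at hp hpre
    obtain ⟨r, rfl⟩ := hpre
    have hzr : (z : ℂ) - r ≠ 0 := by
      intro h
      have := congrArg Complex.im h
      simp at this
      exact z.im_ne_zero this
    apply tendsto_coe_infty_of_norm
    have h1 : Filter.Tendsto (fun n : ℕ => (A 0 0 ^ 2) ^ n * ‖(z : ℂ) - r‖ - ‖(r : ℂ)‖)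
        Filter.atTop Filter.atTop :=
      Filter.tendsto_atTop_add_const_right _ _
        ((tendsto_pow_atTop_atTop_of_one_lt ha).atTop_mul_const (norm_pos_iff.2 hzr))
    refine Filter.tendsto_atTop_mono (fun n => ?_) h1
    rw [coe_pow_smul hA hp, add_comm]
    refine le_trans (le_of_eq ?_) (norm_sub_le_norm_add _ _)
    rw [norm_mul, norm_pow, norm_pow, Complex.norm_real (A 0 0), Real.norm_eq_abs, sq_abs]

lemma conj_mem_wing_iff {h g : G₀} {ξ : OnePoint ℝ} :
    g * h * g⁻¹ ∈ wing (g • ξ) ↔ h ∈ wing ξ := by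
  refine ⟨fun H => ?_, fun H => conj_mem_wing H g⟩
  have := conj_mem_wing H g⁻¹
  rw [inv_smul_smul] at this
  convert this using 1
  group

lemma halfTurn_conj_apply (A : SL(2, ℝ)) :
    (halfTurn⁻¹ * A * halfTurn) 0 0 = A 1 1 ∧ (halfTurn⁻¹ * A * halfTurn) 0 1 = -A 1 0 ∧
    (halfTurn⁻¹ * A * halfTurn) 1 0 = -A 0 1 ∧ (halfTurn⁻¹ * A * halfTurn) 1 1 = A 0 0 := by
  obtain ⟨h1, h2, h3, h4⟩ := halfTurn_apply
  obtain ⟨i1, i2, i3, i4⟩ := sl_inv_apply halfTurn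
  simp [sl_mul_apply, h1, h2, h3, h4, i1, i2, i3, i4]

lemma mem_wing_zero_iff {A : SL(2, ℝ)} :
    (A : G₀) ∈ wing ((0 : ℝ) : OnePoint ℝ) ↔ A 0 1 = 0 ∧ A 0 0 ^ 2 < A 1 1 ^ 2 := by
  obtain ⟨h1, h2, h3, h4⟩ := halfTurn_conj_apply A
  rw [← halfTurn_smul_infty]
  have : (A : G₀) = (halfTurn : G₀) * ((halfTurn⁻¹ * A * halfTurn : SL(2, ℝ)) : G₀) *
      (halfTurn : G₀)⁻¹ := by
    change (A : G₀) = (halfTurn : G₀) * ((halfTurn : G₀)⁻¹ * (A : G₀) * (halfTurn : G₀)) *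
      (halfTurn : G₀)⁻¹
    group
  rw [this, conj_mem_wing_iff, mem_wing_infty_iff, h1, h3, h4, neg_eq_zero]

lemma mk_smul_zero_iff {A : SL(2, ℝ)} :
    (A : G₀) • ((0 : ℝ) : OnePoint ℝ) = ((0 : ℝ) : OnePoint ℝ) ↔ A 0 1 = 0 := by
  obtain ⟨h1, h2, h3, h4⟩ := halfTurn_conj_apply A
  rw [← neg_eq_zero, ← h3, ← mk_smul_infty_iff, ← halfTurn_smul_infty, ← inv_smul_eq_iff,
    ← mul_smul, ← mul_smul]
  rfl

lemma mk_eq_one_iff {A : SL(2, ℝ)} : (A : G₀) = 1 ↔ A = 1 ∨ A = -1 := mk_eq_mk_iff (B := 1)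

lemma smul_vert_eq_iff {A : SL(2, ℝ)} {t : ℝ} :
    (A : G₀) • vert t = vert t ↔ A 0 0 = A 1 1 ∧ A 0 1 = -A 1 0 * Real.exp t ^ 2 := by
  have he : Real.exp t ≠ 0 := (Real.exp_pos t).ne'
  rw [← UpperHalfPlane.coe_inj, coe_mk_smul, div_eq_iff (denom_ne_zero A _), coe_vert,
    Complex.ext_iff]
  simp [-Complex.ofReal_exp]
  constructor
  · rintro ⟨h1, h2⟩
    exact ⟨mul_right_cancel₀ he (by linarith), by linarith⟩
  · rintro ⟨h1, h2⟩
    exact ⟨by rw [h2]; ring, by rw [h1]; ring⟩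

/-- Equal diagonal entries give the stem: an elliptic element fixing `i√(-b/c)` if `bc < 0`, and the
identity or a parabolic element if `bc = 0`. The triangular cases give the wings, and equality in
their inequalities falls back into the stem. -/
lemma mem_leftCrookedPlane_imAxis_iff {A : SL(2, ℝ)} :
    (A : G₀) ∈ leftCrookedPlane imAxis ↔ InCrooked A := by
  have d := sl_det A
  constructor
  · rintro (((⟨-, p, hp, h2⟩ | h1) | ⟨h1, ξ, hξ, h2⟩) | ⟨ξ, hξ, h1⟩)
    · rw [eq_vert_of_re_eq_zero hp, smul_vert_eq_iff] at h2
      refine Or.inl ⟨h2.1, ?_⟩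
      rw [h2.2]
      nlinarith [sq_nonneg (A 1 0 * Real.exp (Real.log p.im))]
    · rw [Set.mem_singleton_iff, mk_eq_one_iff] at h1
      rcases h1 with rfl | rfl
      · exact inCrooked_one
      · exact inCrooked_one.neg
    · rw [isParabolic_mk_iff] at h1
      have h4 : A 0 1 * A 1 0 = 0 → InCrooked A := by
        intro h0
        refine Or.inl ⟨?_, h0.le⟩
        have : (A 0 0 - A 1 1) ^ 2 = 0 := by nlinarith
        exact sub_eq_zero.1 (pow_eq_zero_iff two_ne_zero |>.1 this)
      rcases isEndpoint_imAxis_iff.1 hξ with rfl | rfl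
      · exact h4 (by rw [mk_smul_infty_iff.1 h2, mul_zero])
      · exact h4 (by rw [mk_smul_zero_iff.1 h2, zero_mul])
    · rcases isEndpoint_imAxis_iff.1 hξ with rfl | rfl
      · obtain ⟨h2, h3⟩ := mem_wing_infty_iff.1 h1
        exact Or.inr (Or.inl ⟨h2, h3.le⟩)
      · obtain ⟨h2, h3⟩ := mem_wing_zero_iff.1 h1
        exact Or.inr (Or.inr ⟨h2, h3.le⟩)
  · have stem_case : A 0 0 = A 1 1 → A 0 1 * A 1 0 ≤ 0 → (A : G₀) ∈ leftCrookedPlane imAxis := by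
      intro h h'
      rw [h] at d
      rcases h'.lt_or_eq with hlt | heq
      · refine Or.inl (Or.inl (Or.inl ⟨isElliptic_mk_iff.2 (by rw [h]; nlinarith), ?_⟩))
        have hc : A 1 0 ≠ 0 := fun h0 => by simp [h0] at hlt
        have hr : 0 < -A 0 1 / A 1 0 := by
          have : -A 0 1 / A 1 0 = -(A 0 1 * A 1 0) / A 1 0 ^ 2 := by field_simp
          rw [this]
          have := sq_pos_of_ne_zero hc
          exact div_pos (by linarith) this
        refine ⟨vert (Real.log (√(-A 0 1 / A 1 0))), vert_re _, smul_vert_eq_iff.2 ⟨h, ?_⟩⟩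
        rw [Real.exp_log (Real.sqrt_pos.2 hr), Real.sq_sqrt hr.le]
        field_simp
      · by_cases h1 : (A : G₀) = 1
        · exact Or.inl (Or.inl (Or.inr h1))
        · have hpar : IsParabolic (A : G₀) := isParabolic_mk_iff.2 ⟨h1, by rw [h]; nlinarith⟩
          refine Or.inl (Or.inr ⟨hpar, ?_⟩)
          rcases mul_eq_zero.1 heq with h0 | h0
          · exact ⟨_, isEndpoint_imAxis_zero, mk_smul_zero_iff.2 h0⟩
          · exact ⟨_, isEndpoint_imAxis_infty, mk_smul_infty_iff.2 h0⟩
    have diag_case : A 0 1 * A 1 0 = 0 → A 0 0 ^ 2 = A 1 1 ^ 2 → A 0 0 = A 1 1 := by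
      intro h0 h1
      rcases sq_eq_sq_iff_eq_or_eq_neg.1 h1 with h2 | h2
      · exact h2
      · rw [h2, h0] at d
        nlinarith [sq_nonneg (A 1 1)]
    rintro (⟨h, h'⟩ | ⟨h, h'⟩ | ⟨h, h'⟩)
    · exact stem_case h h'
    · rcases h'.lt_or_eq with hlt | heq
      · exact Or.inr ⟨_, isEndpoint_imAxis_infty, mem_wing_infty_iff.2 ⟨h, hlt⟩⟩
      · have h0 : A 0 1 * A 1 0 = 0 := by rw [h, mul_zero]
        exact stem_case (diag_case h0 heq.symm) h0.le
    · rcases h'.lt_or_eq with hlt | heq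
      · exact Or.inr ⟨_, isEndpoint_imAxis_zero, mem_wing_zero_iff.2 ⟨h, hlt⟩⟩
      · have h0 : A 0 1 * A 1 0 = 0 := by rw [h, zero_mul]
        exact stem_case (diag_case h0 heq) h0.le

/-- Disjointness of right crooked planes in matrix form. -/
lemma disjoint_rightCrookedPlane_iff {g g' : G₀} {x y U V : SL(2, ℝ)}
    (hU : (U : G₀) = (x : G₀)⁻¹ * (g⁻¹ * g') * y) (hV : (V : G₀) = (x : G₀)⁻¹ * y) :
    Disjoint (g • rightCrookedPlane ((x : G₀) • imAxis))
      (g' • rightCrookedPlane ((y : G₀) • imAxis)) ↔ CrookedDisjoint U V := by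
  constructor
  · intro h m M hm hM e
    rw [← mem_leftCrookedPlane_imAxis_iff] at hm hM
    have hm' := conj_mem_leftCrookedPlane hm x
    have hM' := conj_mem_leftCrookedPlane hM y
    have e' : (m : G₀) * U = V * M := congrArg (QuotientGroup.mk (s := Subgroup.center _)) e
    rw [hU, hV] at e'
    refine Set.disjoint_left.1 h (Set.smul_mem_smul_set (Set.inv_mem_inv.2 hm')) ?_
    have : g * ((x : G₀) * m * (x : G₀)⁻¹)⁻¹ = g' * ((y : G₀) * M * (y : G₀)⁻¹)⁻¹ := by
      have e2 : (M : G₀) = ((x : G₀)⁻¹ * y)⁻¹ * (m * ((x : G₀)⁻¹ * (g⁻¹ * g') * y)) := by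
        rw [e', inv_mul_cancel_left]
      rw [e2]
      group
    rw [smul_eq_mul, this]
    exact Set.smul_mem_smul_set (Set.inv_mem_inv.2 hM')
  · intro h
    rw [Set.disjoint_left]
    rintro _ ⟨a, ha, rfl⟩ ⟨b, hb, hab⟩
    rw [rightCrookedPlane, Set.mem_inv, mem_leftCrookedPlane_smul_iff] at ha hb
    obtain ⟨m, hm⟩ := exists_mk ((x : G₀)⁻¹ * a⁻¹ * x)
    obtain ⟨M, hM⟩ := exists_mk ((y : G₀)⁻¹ * b⁻¹ * y)
    rw [← hm, mem_leftCrookedPlane_imAxis_iff] at ha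
    rw [← hM, mem_leftCrookedPlane_imAxis_iff] at hb
    have e : ((m * U : SL(2, ℝ)) : G₀) = ((V * M : SL(2, ℝ)) : G₀) := by
      change (m : G₀) * U = V * M
      rw [hm, hM, hU, hV]
      have hab' : b = g'⁻¹ * (g * a) := by
        rw [eq_inv_mul_iff_mul_eq]
        exact hab
      rw [hab']
      group
    -- The sign ambiguity of lifts is absorbed into `M`, as `InCrooked` is invariant under negation.
    rcases mk_eq_mk_iff.1 e with e | e
    · exact h m M ha hb e
    · exact h m (-M) ha hb.neg (by rw [e, mul_neg])

/-! ### Stem quadrants -/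

lemma hasDerivAt_smul (A : SL(2, ℝ)) {γ : ℝ → ℍ} {v : ℂ}
    (h : HasDerivAt (fun t => (γ t : ℂ)) v 0) :
    HasDerivAt (fun t => (((A : G₀) • γ t : ℍ) : ℂ))
      (v * (((A 1 0 : ℂ) * γ 0 + A 1 1) ^ 2)⁻¹) 0 := by
  have h0 := denom_ne_zero A (γ 0)
  have d : (A 0 0 : ℂ) * A 1 1 - A 0 1 * A 1 0 = 1 := by exact_mod_cast sl_det A
  simp_rw [coe_mk_smul]
  refine (((h.const_mul (A 0 0 : ℂ)).add_const (A 0 1 : ℂ)).div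
    ((h.const_mul (A 1 0 : ℂ)).add_const (A 1 1 : ℂ)) h0).congr_deriv ?_
  rw [div_eq_mul_inv]
  congr 1
  linear_combination v * d

lemma hasDerivAt_vert (s : ℝ) :
    HasDerivAt (fun t => (vert (t + s) : ℂ)) ((Real.exp s : ℂ) * Complex.I) 0 := by
  simp_rw [coe_vert]
  have h : HasDerivAt (fun t => Real.exp (t + s)) (Real.exp s) 0 := by
    have := ((hasDerivAt_id (0 : ℝ)).add_const s).exp
    simpa using this
  exact h.ofReal_comp.mul_const Complex.I

lemma hasDerivAt_smul_vert (A : SL(2, ℝ)) :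
    HasDerivAt (fun t => (((A : G₀) • vert t : ℍ) : ℂ))
      (Complex.I * (((A 1 0 : ℂ) * Complex.I + A 1 1) ^ 2)⁻¹) 0 := by
  have h1 := hasDerivAt_vert 0
  simp only [add_zero, Real.exp_zero, Complex.ofReal_one, one_mul] at h1
  have h := hasDerivAt_smul A h1
  rwa [vert_zero, UpperHalfPlane.coe_I] at h

lemma IsGeodesicLine.smul {L : Set ℍ} (h : IsGeodesicLine L) (g : G₀) : IsGeodesicLine (g • L) := by
  obtain ⟨γ, hγ⟩ := h
  exact ⟨_, hγ.smul g⟩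

lemma IsAxis.conj {h : G₀} {A : Set ℍ} (H : IsAxis h A) (g : G₀) :
    IsAxis (g * h * g⁻¹) (g • A) :=
  ⟨H.1.smul g, by rw [mul_smul, inv_smul_smul, mul_smul, H.2]⟩

lemma IsOrthogonal.smul {A L : Set ℍ} (H : IsOrthogonal A L) (g : G₀) :
    IsOrthogonal (g • A) (g • L) := by
  obtain ⟨x, rfl⟩ := exists_mk g
  obtain ⟨γ, δ, v, w, h1, h2, h3, h4, h5, h6⟩ := H
  refine ⟨_, _, _, _, h1.smul x, h2.smul x, by rw [h3], hasDerivAt_smul x h4,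
    hasDerivAt_smul x h5, ?_⟩
  rw [h3]
  -- Conformality: both velocities are multiplied by the same `k`, hence their inner product by
  -- `|k|²`.
  generalize (((x 1 0 : ℂ) * δ 0 + x 1 1) ^ 2)⁻¹ = k
  rw [Complex.inner] at *
  rw [show w * k * (starRingEnd ℂ) (v * k) =
    ((Complex.normSq k : ℝ) : ℂ) * (w * (starRingEnd ℂ) v) by
      rw [map_mul, Complex.normSq_eq_conj_mul_self]; ring, Complex.re_ofReal_mul, h6, mul_zero]

lemma conj_mem_stemQuadrant {L P : Set ℍ} {h : G₀} (H : h ∈ stemQuadrant L P) (g : G₀) :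
    g * h * g⁻¹ ∈ stemQuadrant (g • L) (g • P) := by
  obtain ⟨h1, A, h2, h3, p, hp, h4⟩ := H
  refine ⟨h1.conj g, g • A, h2.conj g, h3.smul g, g • p,
    ⟨Set.smul_mem_smul_set hp.1, Set.smul_mem_smul_set hp.2⟩, ?_⟩
  rw [mul_smul, inv_smul_smul, mul_smul]
  exact Set.smul_mem_smul_set h4

lemma mem_stemQuadrant_smul_iff {L P : Set ℍ} {g h : G₀} :
    h ∈ stemQuadrant (g • L) (g • P) ↔ g⁻¹ * h * g ∈ stemQuadrant L P := by
  constructor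
  · intro H
    simpa using conj_mem_stemQuadrant H g⁻¹
  · intro H
    simpa [mul_assoc] using conj_mem_stemQuadrant H g

lemma smul_vert_mem_imAxis_iff {A : SL(2, ℝ)} {t : ℝ} : (A : G₀) • vert t ∈ imAxis ↔
    A 0 0 * A 1 0 * Real.exp t ^ 2 + A 0 1 * A 1 1 = 0 := by
  rw [mem_imAxis_iff, vert_re, vert_im]
  simp

/-- A geodesic line orthogonal to the imaginary axis is symmetric about it. -/
lemma IsOrthogonal.exists_smul {A : Set ℍ} (H : IsOrthogonal A imAxis) :
    ∃ a : SL(2, ℝ), A = (a : G₀) • imAxis ∧ a 0 0 * a 1 1 + a 0 1 * a 1 0 = 0 := by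
  obtain ⟨γ, δ, v, w, h1, h2, h3, h4, h5, h6⟩ := H
  obtain ⟨a, ha, hA⟩ := h1.exists_smul_vert
  obtain ⟨b, hb, -⟩ := h2.exists_smul_vert
  refine ⟨a, hA, ?_⟩
  have d := sl_det a
  simp_rw [ha] at h4
  have hδ : ∀ t, (δ t).re = 0 := fun t => by
    have : δ t ∈ Set.range δ := ⟨t, rfl⟩
    rw [h2.2] at this
    exact this
  have hw : w.re = 0 := by
    have h7 : HasDerivAt (fun t => (δ t : ℂ).re) w.re 0 :=
      Complex.reCLM.hasFDerivAt.comp_hasDerivAt 0 h5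
    have h8 : (fun t => (δ t : ℂ).re) = fun _ => 0 := funext hδ
    rw [h8] at h7
    exact h7.unique (hasDerivAt_const _ _)
  have hw0 : w.im ≠ 0 := by
    intro h0
    have hw' : w = 0 := Complex.ext hw h0
    simp_rw [hb] at h5
    have h9 := h5.unique (hasDerivAt_smul_vert b)
    rw [hw'] at h9
    have h10 := denom_ne_zero b UpperHalfPlane.I
    rw [UpperHalfPlane.coe_I] at h10
    exact mul_ne_zero Complex.I_ne_zero (inv_ne_zero (pow_ne_zero 2 h10)) h9.symm
  have hv : v.im = 0 := by
    rw [Complex.inner] at h6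
    simp [hw] at h6
    exact h6.resolve_left hw0
  have hv' := h4.unique (hasDerivAt_smul_vert a)
  have h10 := denom_ne_zero a UpperHalfPlane.I
  rw [UpperHalfPlane.coe_I] at h10
  have h11 : v * ((a 1 0 : ℂ) * Complex.I + a 1 1) ^ 2 = Complex.I := by
    rw [hv', mul_assoc, inv_mul_cancel₀ (pow_ne_zero 2 h10), mul_one]
  have hre := congrArg Complex.re h11
  have him := congrArg Complex.im h11
  simp [sq, hv] at hre him
  -- The velocity `v` is real and nonzero, and `v * (a 1 0 * i + a 1 1)²` is purely imaginary.
  have hsq : a 1 1 ^ 2 = a 1 0 ^ 2 := by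
    rcases hre with h | h
    · simp [h] at him
    · linarith
  have h12 : (a : G₀) • vert 0 ∈ imAxis := by
    rw [← ha, h3]
    exact hδ 0
  rw [smul_vert_mem_imAxis_iff, Real.exp_zero, one_pow, mul_one] at h12
  have e1 : (a 0 0 * a 1 1 + a 0 1 * a 1 0) * a 1 1 = 0 := by
    linear_combination (a 1 0) * h12 + a 0 0 * hsq
  have e2 : (a 0 0 * a 1 1 + a 0 1 * a 1 0) * a 1 0 = 0 := by
    linear_combination (a 1 1) * h12 - a 0 1 * hsq
  rcases mul_eq_zero.1 e1 with e | e
  · exact e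
  rcases mul_eq_zero.1 e2 with e' | e'
  · exact e'
  · rw [e, e'] at d
    norm_num at d

/-- Preserving two points' membership in the axis makes `B` diagonal or antidiagonal, and an
antidiagonal matrix has trace 0. -/
lemma diagonal_of_smul_imAxis {B : SL(2, ℝ)} (hB : (B : G₀) • imAxis = imAxis)
    (hh : 4 < (B 0 0 + B 1 1) ^ 2) : B 0 1 = 0 ∧ B 1 0 = 0 := by
  have d := sl_det B
  have hmem : ∀ t, B 0 0 * B 1 0 * Real.exp t ^ 2 + B 0 1 * B 1 1 = 0 := fun t => by
    rw [← smul_vert_mem_imAxis_iff]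
    have := Set.smul_mem_smul_set (a := (B : G₀)) (show vert t ∈ imAxis from vert_re t)
    rwa [hB] at this
  have m0 := hmem 0
  have m1 := hmem (Real.log 2)
  rw [Real.exp_zero] at m0
  rw [Real.exp_log two_pos] at m1
  have z1 : B 0 0 * B 1 0 = 0 := by linarith
  have z2 : B 0 1 * B 1 1 = 0 := by linarith
  rcases mul_eq_zero.1 z1 with h | h <;> rcases mul_eq_zero.1 z2 with h' | h'
  · rw [h, h'] at d
    norm_num at d
  · rw [h, h'] at hh
    norm_num at hh
  · exact ⟨h', h⟩
  · rw [h, h'] at d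
    norm_num at d

lemma smul_imAxis_of_diagonal {B : SL(2, ℝ)} (h01 : B 0 1 = 0) (h10 : B 1 0 = 0) :
    (B : G₀) • imAxis = imAxis := by
  have key : ∀ C : SL(2, ℝ), C 0 1 = 0 → C 1 0 = 0 → (C : G₀) • imAxis ⊆ imAxis := by
    rintro C hC hC' _ ⟨z, hz, rfl⟩
    have hz : z.re = 0 := hz
    change (C : G₀) • z ∈ imAxis
    rw [mem_imAxis_iff, hC, hC', hz]
    ring
  obtain ⟨i1, i2, i3, i4⟩ := sl_inv_apply B
  refine (key B h01 h10).antisymm ?_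
  rw [Set.subset_smul_set_iff]
  exact key B⁻¹ (by rw [i2, h01, neg_zero]) (by rw [i3, h10, neg_zero])

/-- An axis with endpoints symmetric about 0 forces equal diagonal entries, and hyperbolicity forces
off-diagonal entries of the same sign. The direction of translation fixes that sign relative to the
diagonal, and the choice of lift makes the diagonal positive. -/
lemma exists_inQuadrant_of_mem_stemQuadrant {h : G₀} (H : h ∈ stemQuadrant imAxis leftHalf) :
    ∃ K : SL(2, ℝ), InQuadrant K ∧ (K : G₀) = h := by
  obtain ⟨K, rfl⟩ := exists_mk h
  obtain ⟨h1, A, h2, h3, p, hp, h4⟩ := H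
  obtain ⟨a, rfl, ha⟩ := h3.exists_smul
  rw [isHyperbolic_mk_iff] at h1
  obtain ⟨B, hB⟩ : ∃ B : SL(2, ℝ), B = a⁻¹ * K * a := ⟨_, rfl⟩
  have hK : K = a * B * a⁻¹ := by rw [hB]; group
  have hBI : (B : G₀) • imAxis = imAxis := by
    have e : (B : G₀) = (a : G₀)⁻¹ * K * a := by rw [hB]; rfl
    rw [e, mul_smul, mul_smul, h2.2, inv_smul_smul]
  have htr := sl_conj_trace a B
  rw [← hK] at htr
  obtain ⟨b1, b2⟩ := diagonal_of_smul_imAxis hBI (by rw [← htr]; exact h1)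
  obtain ⟨i1, i2, i3, i4⟩ := sl_inv_apply a
  have hdiag : K 1 1 = K 0 0 := by
    rw [hK]
    simp only [sl_mul_apply, i1, i2, i3, i4, b1, b2]
    linear_combination (B 1 1 - B 0 0) * ha
  have d := sl_det K
  rw [hdiag] at h1 d
  have hpos : 0 < K 0 1 * K 1 0 := by nlinarith
  have hpre : p.re = 0 := hp.2
  rw [mem_leftHalf_iff, hpre, hdiag] at h4
  have h5 : K 0 0 * (K 1 0 * p.im ^ 2 + K 0 1) < 0 := by linarith
  have him := p.im_pos
  rcases mul_neg_iff.1 h5 with ⟨k1, k2⟩ | ⟨k1, k2⟩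
  · refine ⟨K, ⟨k1, hdiag, ?_⟩, rfl⟩
    rcases pos_and_pos_or_neg_and_neg_of_mul_pos hpos with ⟨l1, l2⟩ | ⟨l1, l2⟩
    · have : 0 < K 1 0 * p.im ^ 2 := by positivity
      linarith
    · exact ⟨l1, l2⟩
  · refine ⟨-K, ⟨?_, ?_, ?_⟩, mk_neg K⟩
    · rw [sl_neg_apply]; linarith
    · rw [sl_neg_apply, sl_neg_apply, hdiag]
    · rw [sl_neg_apply, sl_neg_apply]
      rcases pos_and_pos_or_neg_and_neg_of_mul_pos hpos with ⟨l1, l2⟩ | ⟨l1, l2⟩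
      · exact ⟨by linarith, by linarith⟩
      · have : K 1 0 * p.im ^ 2 < 0 := mul_neg_of_neg_of_pos l2 (by positivity)
        linarith

lemma InQuadrant.mem_stemQuadrant {K : SL(2, ℝ)} (hK : InQuadrant K) :
    (K : G₀) ∈ stemQuadrant imAxis leftHalf := by
  have h1 := hK.one_lt
  obtain ⟨k0, k1, k2, k3⟩ := hK
  obtain ⟨κ, hκ⟩ : ∃ κ, κ = √(K 0 1 * K 1 0) := ⟨_, rfl⟩
  have hpos : 0 < K 0 1 * K 1 0 := mul_pos_of_neg_of_neg k2 k3
  have κ0 : 0 < κ := by rw [hκ]; exact Real.sqrt_pos.2 hpos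
  have κ2 : κ ^ 2 = K 0 1 * K 1 0 := by rw [hκ, Real.sq_sqrt hpos.le]
  -- The fixed points of `K` are `±ρ`. The matrix `a` below sends `∞`, `0`, `i` to `ρ`, `-ρ`, `iρ`,
  -- so it carries the imaginary axis to the axis of `K`; `ν` normalizes its determinant.
  obtain ⟨ρ, hρ⟩ : ∃ ρ, ρ = -K 0 1 / κ := ⟨_, rfl⟩
  have ρ0 : 0 < ρ := by rw [hρ]; exact div_pos (neg_pos.2 k2) κ0
  have e01 : K 0 1 = -(κ * ρ) := by rw [hρ]; field_simp
  have e10 : K 1 0 * ρ = -κ := by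
    rw [hρ]
    field_simp
    linarith
  obtain ⟨ν, hν⟩ : ∃ ν, ν = √(1 / (2 * ρ)) := ⟨_, rfl⟩
  have ν0 : 0 < ν := by rw [hν]; exact Real.sqrt_pos.2 (by positivity)
  have ν2 : 2 * ρ * ν ^ 2 = 1 := by
    rw [hν, Real.sq_sqrt (by positivity)]
    field_simp
  have hdet : ρ * ν * ν - -(ρ * ν) * ν = 1 := by linear_combination ν2
  obtain ⟨a1, a2, a3, a4⟩ := slMk_apply _ _ _ _ hdet
  obtain ⟨a, ha⟩ : ∃ a, a = slMk _ _ _ _ hdet := ⟨_, rfl⟩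
  rw [← ha] at a1 a2 a3 a4
  obtain ⟨i1, i2, i3, i4⟩ := sl_inv_apply a
  have ha0 : (a : G₀) • vert 0 = vert (Real.log ρ) := by
    rw [← UpperHalfPlane.coe_inj, coe_mk_smul, div_eq_iff (denom_ne_zero a _), coe_vert, coe_vert,
      Real.exp_log ρ0, Real.exp_zero, a1, a2, a3, a4]
    push_cast
    linear_combination (-(ρ * ν : ℂ)) * Complex.I_mul_I
  refine ⟨?_, (a : G₀) • imAxis, ⟨isParametrization_vert.smul a |> fun h => ⟨_, h⟩, ?_⟩,
    ⟨fun t => (a : G₀) • vert t, fun t => vert (t + Real.log ρ), _, _,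
      isParametrization_vert.smul a, ⟨isParametrization_vert.1.comp ?_, ?_⟩, ?_,
      hasDerivAt_smul_vert a, hasDerivAt_vert (Real.log ρ), ?_⟩, vert (Real.log ρ), ⟨?_, ?_⟩, ?_⟩
  · rw [isHyperbolic_mk_iff, k1]
    nlinarith
  · have hd : ((a⁻¹ * K * a : SL(2, ℝ)) : G₀) • imAxis = imAxis := by
      apply smul_imAxis_of_diagonal
      · simp only [sl_mul_apply, i1, i2, a2, a4, k1, e01]
        linear_combination (-ρ * ν ^ 2) * e10
      · simp only [sl_mul_apply, i3, i4, a1, a3, k1, e01]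
        linear_combination (ρ * ν ^ 2) * e10
    have e : ((a⁻¹ * K * a : SL(2, ℝ)) : G₀) = (a : G₀)⁻¹ * K * a := rfl
    rw [e, mul_smul, mul_smul, inv_smul_eq_iff] at hd
    exact hd
  · exact Isometry.of_dist_eq fun s t => by simp
  · rw [← isParametrization_vert.2]
    exact (add_right_surjective (Real.log ρ)).range_comp vert
  · simp only [zero_add]
    exact ha0
  · have e : Complex.I * (((a 1 0 : ℂ) * Complex.I + a 1 1) ^ 2)⁻¹ = (ρ : ℂ) := by
      have hne := denom_ne_zero a UpperHalfPlane.I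
      rw [UpperHalfPlane.coe_I] at hne
      rw [← div_eq_mul_inv, div_eq_iff (pow_ne_zero 2 hne), a3, a4]
      have ν2' : (2 * ρ * ν ^ 2 : ℂ) = 1 := by exact_mod_cast ν2
      linear_combination (-Complex.I) * ν2' - (ρ * ν ^ 2 : ℂ) * Complex.I_mul_I
    rw [e, Complex.inner]
    simp [-Complex.ofReal_exp]
  · rw [← ha0]
    exact Set.smul_mem_smul_set (vert_re 0)
  · exact vert_re _
  · rw [mem_leftHalf_iff, vert_re, vert_im, Real.exp_log ρ0, k1]
    have : K 1 0 * ρ ^ 2 < 0 := mul_neg_of_neg_of_pos k3 (by positivity)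
    nlinarith

/-- The half-turn exchanges the two sides and conjugates `K⁻¹` to the transpose of `K`, which is
again in the quadrant. -/
lemma InQuadrant.inv_mem_stemQuadrant {K : SL(2, ℝ)} (hK : InQuadrant K) :
    (K : G₀)⁻¹ ∈ stemQuadrant imAxis rightHalf := by
  obtain ⟨h1, h2, h3, h4⟩ := halfTurn_conj_apply K⁻¹
  obtain ⟨i1, i2, i3, i4⟩ := sl_inv_apply K
  rw [i4] at h1
  rw [i3, neg_neg] at h2
  rw [i2, neg_neg] at h3
  rw [i1] at h4
  rw [← halfTurn_smul_leftHalf, ← halfTurn_smul_imAxis, mem_stemQuadrant_smul_iff]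
  refine InQuadrant.mem_stemQuadrant (K := halfTurn⁻¹ * K⁻¹ * halfTurn) ?_
  exact ⟨by rw [h1]; exact hK.1, by rw [h1, h4, hK.2.1], by rw [h2]; exact hK.2.2.2,
    by rw [h3]; exact hK.2.2.1⟩

lemma exists_inQuadrant_of_mem_stemQuadrant_rightHalf {h : G₀}
    (H : h ∈ stemQuadrant imAxis rightHalf) : ∃ K : SL(2, ℝ), InQuadrant K ∧ (K : G₀) = h⁻¹ := by
  rw [← halfTurn_smul_leftHalf, ← halfTurn_smul_imAxis, mem_stemQuadrant_smul_iff] at H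
  obtain ⟨K, hK, e⟩ := exists_inQuadrant_of_mem_stemQuadrant H
  obtain ⟨h1, h2, h3, h4⟩ := halfTurn_conj_apply K⁻¹
  obtain ⟨i1, i2, i3, i4⟩ := sl_inv_apply K
  rw [i4] at h1
  rw [i3, neg_neg] at h2
  rw [i2, neg_neg] at h3
  rw [i1] at h4
  refine ⟨halfTurn⁻¹ * K⁻¹ * halfTurn, ⟨by rw [h1]; exact hK.1, by rw [h1, h4, hK.2.1],
    by rw [h2]; exact hK.2.2.2, by rw [h3]; exact hK.2.2.1⟩, ?_⟩
  have hJ : (halfTurn : G₀)⁻¹ = halfTurn := by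
    change ((halfTurn⁻¹ : SL(2, ℝ)) : G₀) = halfTurn
    rw [mk_eq_mk_iff]
    obtain ⟨t1, t2, t3, t4⟩ := halfTurn_apply
    obtain ⟨j1, j2, j3, j4⟩ := sl_inv_apply halfTurn
    exact Or.inr (sl_ext (by simp [j1, sl_neg_apply, t1, t4]) (by simp [j2, sl_neg_apply])
      (by simp [j3, sl_neg_apply]) (by simp [j4, sl_neg_apply, t1, t4]))
  change (halfTurn : G₀)⁻¹ * (K : G₀)⁻¹ * halfTurn = h⁻¹
  rw [e, mul_inv_rev, mul_inv_rev, inv_inv]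
  nth_rewrite 3 [← hJ]
  nth_rewrite 2 [← hJ]
  group

/-! ### Transversely oriented lines -/

lemma smul_notMem_of_disjoint {a b : G₀} {S T : Set ℍ} (h : Disjoint (a • S) (b • T)) {z : ℍ}
    (hz : z ∈ T) : (a⁻¹ * b) • z ∉ S := fun hS =>
  Set.disjoint_left.1 h (Set.mem_smul_set_iff_inv_smul_mem.2 (by rwa [mul_smul] at hS))
    (Set.smul_mem_smul_set hz)

lemma disjoint_of_smul_notMem {a b : G₀} {S T : Set ℍ} (h : ∀ z ∈ T, (a⁻¹ * b) • z ∉ S) :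
    Disjoint (a • S) (b • T) := by
  rw [Set.disjoint_left]
  rintro _ hS ⟨z, hz, rfl⟩
  refine h z hz ?_
  rw [mul_smul]
  exact Set.mem_smul_set_iff_inv_smul_mem.1 hS

lemma exists_nonneg_of_disjoint {a b : G₀} (h : Disjoint (a • leftHalf) (b • rightHalf)) :
    ∃ V : SL(2, ℝ), (V : G₀) = a⁻¹ * b ∧ ∀ i j, 0 ≤ V i j := by
  obtain ⟨V, hV⟩ := exists_mk (a⁻¹ * b)
  have key : (∀ i j, 0 ≤ V i j) ∨ ∀ i j, 0 ≤ (-V) i j := by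
    apply nonneg_of_side
    intro X Y hX hY
    have h1 := smul_notMem_of_disjoint h (z := ⟨⟨X, Y⟩, hY⟩) hX
    rw [← hV, mem_leftHalf_iff, not_lt] at h1
    exact h1
  rcases key with h1 | h1
  · exact ⟨V, hV, h1⟩
  · exact ⟨-V, by rw [mk_neg, hV], h1⟩

lemma exists_smul_leftHalf {L P : Set ℍ} (hL : IsGeodesicLine L) (hP : IsSide L P) :
    ∃ x : SL(2, ℝ), L = (x : G₀) • imAxis ∧ P = (x : G₀) • leftHalf := by
  obtain ⟨x, rfl⟩ := hL.exists_eq_smul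
  rcases isSide_smul_imAxis_iff.1 hP with rfl | rfl
  · exact ⟨x, rfl, rfl⟩
  · refine ⟨x * halfTurn, ?_, ?_⟩ <;> change _ = ((x : G₀) * (halfTurn : G₀)) • _
    · rw [mul_smul, halfTurn_smul_imAxis]
    · rw [mul_smul, halfTurn_smul_leftHalf]

lemma exists_smul_rightHalf {L P : Set ℍ} (hL : IsGeodesicLine L) (hP : IsSide L P) :
    ∃ x : SL(2, ℝ), L = (x : G₀) • imAxis ∧ P = (x : G₀) • rightHalf := by
  obtain ⟨x, rfl⟩ := hL.exists_eq_smul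
  rcases isSide_smul_imAxis_iff.1 hP with rfl | rfl
  · refine ⟨x * halfTurn, ?_, ?_⟩ <;> change _ = ((x : G₀) * (halfTurn : G₀)) • _
    · rw [mul_smul, halfTurn_smul_imAxis]
    · rw [mul_smul, halfTurn_smul_rightHalf]
  · exact ⟨x, rfl, rfl⟩

lemma smul_mem_rightHalf_of_pos {V : SL(2, ℝ)} (h : ∀ i j, 0 < V i j) {z : ℍ} (hz : 0 ≤ z.re) :
    (V : G₀) • z ∈ rightHalf := by
  rw [mem_rightHalf_iff]
  have := h 0 0
  have := h 0 1
  have := h 1 0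
  have := h 1 1
  have := z.im_pos
  positivity

/-- Pairs of lines with disjoint crooked planes can be put in standard position. -/
lemma exists_standard_position {x y : SL(2, ℝ)} (h : ∃ U : SL(2, ℝ), CrookedDisjoint U (x⁻¹ * y)) :
    ∃ x' y' : SL(2, ℝ), (x' : G₀) • imAxis = (x : G₀) • imAxis ∧
      (y' : G₀) • imAxis = (y : G₀) • imAxis ∧ ∀ i j, 0 < (x'⁻¹ * y') i j := by
  obtain ⟨U, hU⟩ := h
  obtain ⟨ε, δ, hε, hδ, hpos⟩ := exists_halfTurn_pos hU.entries_pos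
  refine ⟨x * ε⁻¹, y * δ, ?_, ?_, ?_⟩
  · change ((x : G₀) * (ε : G₀)⁻¹) • imAxis = _
    rw [mul_smul]
    congr 1
    rw [inv_smul_eq_iff]
    rcases hε with rfl | rfl
    · exact (one_smul G₀ _).symm
    · exact halfTurn_smul_imAxis.symm
  · change ((y : G₀) * (δ : G₀)) • imAxis = _
    rw [mul_smul]
    congr 1
    rcases hδ with rfl | rfl | rfl | rfl
    · exact one_smul G₀ _
    · exact halfTurn_smul_imAxis
    · rw [mk_neg]
      exact one_smul G₀ _
    · rw [mk_neg]
      exact halfTurn_smul_imAxis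
  · rw [mul_inv_rev, inv_inv, mul_assoc, ← mul_assoc x⁻¹, ← mul_assoc]
    exact hpos

/-! ### The two implications -/

lemma disjoint_and_mem_of_disjoint_rightCrookedPlane {ℓ ℓ' : Set ℍ} (hℓ : IsGeodesicLine ℓ)
    (hℓ' : IsGeodesicLine ℓ') {g g' : G₀}
    (h : Disjoint (g • rightCrookedPlane ℓ) (g' • rightCrookedPlane ℓ')) :
    Disjoint ℓ ℓ' ∧
      ∃ P P' : Set ℍ, IsSide ℓ P ∧ IsSide ℓ' P' ∧ AwayFromEachOther P P' ∧
        g⁻¹ * g' ∈ stemQuadrant ℓ P * (stemQuadrant ℓ' P')⁻¹ := by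
  obtain ⟨x₀, rfl⟩ := hℓ.exists_eq_smul
  obtain ⟨y₀, rfl⟩ := hℓ'.exists_eq_smul
  obtain ⟨G, hG⟩ := exists_mk (g⁻¹ * g')
  have hU₀ : ∀ x y : SL(2, ℝ), ((x⁻¹ * G * y : SL(2, ℝ)) : G₀) = (x : G₀)⁻¹ * (g⁻¹ * g') * y :=
    fun x y => by rw [← hG]; rfl
  obtain ⟨x, y, hx, hy, hpos⟩ := exists_standard_position
    ⟨_, (disjoint_rightCrookedPlane_iff (hU₀ x₀ y₀) rfl).1 h⟩
  rw [← hx, ← hy] at h ⊢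
  have hC := (disjoint_rightCrookedPlane_iff (V := x⁻¹ * y) (hU₀ x y) rfl).1 h
  obtain ⟨K, K', hK, hK', e⟩ := exists_factorization (U := x⁻¹ * G * y) (V := x⁻¹ * y)
    fun i j => by
      have := hC.abs_lt i j
      rwa [abs_of_pos (hpos i j)] at this
  have e' : (x : G₀)⁻¹ * (g⁻¹ * g') * y = (K : G₀) * ((x : G₀)⁻¹ * y) * K' := by
    rw [← hU₀ x y]
    change _ = ((K * (x⁻¹ * y) * K' : SL(2, ℝ)) : G₀)
    rw [mk_eq_mk_iff]
    exact e.imp id neg_eq_iff_eq_neg.1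
  refine ⟨?_, (x : G₀) • leftHalf, (y : G₀) • rightHalf, isSide_smul_imAxis_iff.2 (Or.inl rfl),
    isSide_smul_imAxis_iff.2 (Or.inr rfl), ?_, ?_⟩
  -- Positivity of the entries of `x⁻¹ * y` sends the closed right half-plane into the open one,
  -- which separates both the lines and their chosen sides.
  · refine disjoint_of_smul_notMem fun z (hz : z.re = 0) h0 => ?_
    have h1 : 0 < (((x : G₀)⁻¹ * (y : G₀)) • z).re := smul_mem_rightHalf_of_pos hpos hz.ge
    exact h1.ne' h0
  · refine disjoint_of_smul_notMem fun z (hz : 0 < z.re) h0 => ?_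
    exact Set.disjoint_right.1 disjoint_leftHalf_rightHalf (smul_mem_rightHalf_of_pos hpos hz.le) h0
  · refine Set.mem_mul.2 ⟨(x : G₀) * K * (x : G₀)⁻¹,
      conj_mem_stemQuadrant hK.mem_stemQuadrant x, ((y : G₀) * (K' : G₀)⁻¹ * (y : G₀)⁻¹)⁻¹,
      Set.inv_mem_inv.2 (conj_mem_stemQuadrant hK'.inv_mem_stemQuadrant y), ?_⟩
    have e2 : g⁻¹ * g' = x * ((x : G₀)⁻¹ * (g⁻¹ * g') * y) * (y : G₀)⁻¹ := by group
    rw [e2, e']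
    group

/-- The two orientation hypotheses provide nonnegative lifts `V` and `U`; membership in the product
of quadrants then gives the entrywise inequalities that imply disjointness. -/
lemma disjoint_rightCrookedPlane_of_mem {ℓ ℓ' P P' : Set ℍ} (hℓ : IsGeodesicLine ℓ)
    (hℓ' : IsGeodesicLine ℓ') {g g' : G₀} (hP : IsSide ℓ P) (hP' : IsSide ℓ' P')
    (haway : AwayFromEachOther P P')
    (hmem : g⁻¹ * g' ∈ stemQuadrant ℓ P * (stemQuadrant ℓ' P')⁻¹)
    (haway' : AwayFromEachOther (g • P) (g' • P')) :
    Disjoint (g • rightCrookedPlane ℓ) (g' • rightCrookedPlane ℓ') := by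
  obtain ⟨x, rfl, rfl⟩ := exists_smul_leftHalf hℓ hP
  obtain ⟨y, rfl, rfl⟩ := exists_smul_rightHalf hℓ' hP'
  obtain ⟨V, hV, hV0⟩ := exists_nonneg_of_disjoint haway
  obtain ⟨U, hU, hU0⟩ := exists_nonneg_of_disjoint
    (a := g * x) (b := g' * y) (by rwa [mul_smul, mul_smul])
  have hU' : (U : G₀) = (x : G₀)⁻¹ * (g⁻¹ * g') * y := by
    rw [hU]
    group
  rw [disjoint_rightCrookedPlane_iff hU' hV]
  obtain ⟨k, hk, k', hk', e⟩ := hmem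
  rw [Set.mem_inv, mem_stemQuadrant_smul_iff] at hk'
  rw [mem_stemQuadrant_smul_iff] at hk
  obtain ⟨K, hK, eK⟩ := exists_inQuadrant_of_mem_stemQuadrant hk
  obtain ⟨K', hK', eK'⟩ := exists_inQuadrant_of_mem_stemQuadrant_rightHalf hk'
  have e2 : (U : G₀) = ((K * V * K' : SL(2, ℝ)) : G₀) := by
    change (U : G₀) = (K : G₀) * V * K'
    rw [hU', ← e, eK, hV, eK']
    simp only
    group
  rcases mk_eq_mk_iff.1 e2 with e3 | e3
  · exact crookedDisjoint_of_abs_lt (hK.abs_lt hK' hU0 e3)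
  -- The other sign would give `|U 0 0| < -V 0 0`, impossible for nonnegative `V`.
  · exfalso
    have h1 := hK.abs_lt hK' (V := -V) hU0 (by rw [e3, mul_neg, neg_mul]) 0 0
    rw [sl_neg_apply] at h1
    linarith [abs_nonneg (U 0 0), hV0 0 0]

end AdSCrooked

open AdSCrooked
theorem theoremB2 (ℓ ℓ' : Set ℍ) (hℓ : IsGeodesicLine ℓ) (hℓ' : IsGeodesicLine ℓ') (g g' : G₀) :
    (Disjoint (g • rightCrookedPlane ℓ) (g' • rightCrookedPlane ℓ') →
      Disjoint ℓ ℓ' ∧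
        ∃ P P' : Set ℍ, IsSide ℓ P ∧ IsSide ℓ' P' ∧ AwayFromEachOther P P' ∧
          g⁻¹ * g' ∈ stemQuadrant ℓ P * (stemQuadrant ℓ' P')⁻¹) ∧
    (∀ P P' : Set ℍ, IsSide ℓ P → IsSide ℓ' P' →
      Disjoint ℓ ℓ' → AwayFromEachOther P P' →
      g⁻¹ * g' ∈ stemQuadrant ℓ P * (stemQuadrant ℓ' P')⁻¹ →
      Disjoint (g • ℓ) (g' • ℓ') → AwayFromEachOther (g • P) (g' • P') →
      Disjoint (g • rightCrookedPlane ℓ) (g' • rightCrookedPlane ℓ')) :=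
  ⟨disjoint_and_mem_of_disjoint_rightCrookedPlane hℓ hℓ',
    fun _ _ hP hP' _ haway hmem _ haway' =>
      disjoint_rightCrookedPlane_of_mem hℓ hℓ' hP hP' haway hmem haway'⟩
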